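/- Fix an integer $m\ge 1$. All graphs are simple. For finite graphs $F,G$ let $t(F,G)=\hom(F,G)/|G|^{|F|}$; a sequence $(G_n)$ of finite graphs is left-convergent if $t(F,G_n)$ converges for every finite graph $F$. A Borel graph $(H,\nu)$ is a graph on a standard Borel space $V$ with Borel edge set in $V\times V$ and a probability measure $\nu$ on $V$. For a finite graph $F$ on $\{1,\dots,p\}$ let $t(F,H)$ be the $\nu^{\otimes p}$-measure of the set of homomorphisms from $F$ to $H$. For a formula $\phi$ with $p$ free variables in the language of graphs (with equality), let $\langle\phi,H\rangle=\nu^{\otimes p}(\phi(H))$ and, for finite $G$, $\langle\phi,G\rangle=|\phi(G)|/|G|^p$. $H$ is the left limit of $(G_n)$ if $t(F,G_n)\to t(F,H)$ for all finite graphs $F$, and its QF-limit if $\langle\phi,G_n\rangle\to\langle\phi,H\rangle$ for all quantifier-free $\phi$. A graph $G$ is an $m$-partite cograph if there is a finite rooted tree whose leaves are the vertices of $G$, a labelling of the leaves by $\{1,\dots,m\}$, and an assignment of a symmetric function $f_v:\{1,\dots,m\}^2\to\{0,1\}$ to each internal node $v$, such that distinct vertices $x,y$ with labels $i,j$ and least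 common ancestor $v$ are adjacent iff $f_v(i,j)=1$. A Borel tree-semilattice is a standard Borel space $T$, given with a Polish topology generating its $\sigma$-algebra, with a Borel meet-semilattice operation $\wedge:T\times T\to T$ such that any two elements below a common element are comparable. It is colored by Borel unary relations $M_s\subseteq T$, where the index $s$ ranges over the labels $1,\dots,m$ and the symmetric functions $f:\{1,\dots,m\}^2\to\{0,1\}$; an element $x$ has color $s$ if $s$ is the only index with $x\in M_s$. For a probability measure $\mu$ on $T$, the interpretation $\mathsf I(\mathbf T,\mu)$ is the Borel graph with vertex set the support of $\mu$, with the restriction of $\mu$ as measure, in which $x,y$ are adjacent iff there are $i,j\in\{1,\dots,m\}$ and a symmetric $f$ with $f(i,j)=1$ such that $x$ has color $i$, $y$ has color $j$ and $x\wedge y$ has color $f$. $(\mathbf T,\mu)$ is atomless if $\mu(\{x\})=0$ for all $x\in T$. **Theorem.** 1. For every left-convergent sequence $(G_n)$ of $m$-partite cographs there is an atomless colored Borel tree-semilattice $(\mathbf T,\mu)$ such that $\mathsf I(\mathbf T,\mu)$ is the left limit of $(G_n)$; if moreover $|G_n|\to\infty$, then $\mathsf I(\mathbf T,\mu)$ is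 also the QF-limit of $(G_n)$. 2. Conversely, for every atomless colored Borel tree-semilattice $(\mathbf T,\mu)$ there is a sequence of $m$-partite cographs $G_n$ with $|G_n|\to\infty$ such that $\mathsf I(\mathbf T,\mu)$ is both the left limit and the QF-limit of $(G_n)$. -/

import Mathlib

open MeasureTheory Filter Topology

universe u v

/-! ### Finite graphs: densities, left convergence, `m`-partite cographs -/

/-- The homomorphism density `t(F, G) = hom(F, G) / |G| ^ |F|` of a finite graph `F` in a finite
graph `G`. -/
noncomputable def homDensity {W : Type u} {V : Type v} (F : SimpleGraph W) (G : SimpleGraph V) :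
    ℝ :=
  (Nat.card (F →g G) : ℝ) / (Nat.card V : ℝ) ^ Nat.card W

/-- The solution set `φ(G)` in `V ^ p` of a first order formula `φ` with `p` free variables in the
language of graphs (one binary relation symbol, and equality). -/
def formulaSet {V : Type u} {p : ℕ} (φ : FirstOrder.Language.graph.Formula (Fin p))
    (G : SimpleGraph V) : Set (Fin p → V) :=
  {x | @FirstOrder.Language.Formula.Realize FirstOrder.Language.graph V G.structure (Fin p) φ x}

/-- The Stone pairing `⟨φ, G⟩ = |φ(G)| / |G| ^ p` of a formula with a finite graph. -/
noncomputable def stonePairing {V : Type u} {p : ℕ}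
    (φ : FirstOrder.Language.graph.Formula (Fin p)) (G : SimpleGraph V) : ℝ :=
  (Nat.card (formulaSet φ G) : ℝ) / (Nat.card V : ℝ) ^ p

/-- A sequence of finite graphs is left-convergent if `t(F, G n)` converges for every finite graph
`F`. -/
def LeftConvergent {V : ℕ → Type u} (G : ∀ n, SimpleGraph (V n)) : Prop :=
  ∀ (p : ℕ) (F : SimpleGraph (Fin p)), ∃ L : ℝ, Tendsto (fun n => homDensity F (G n)) atTop (𝓝 L)

/-- The symmetric functions `{1, …, m} × {1, …, m} → {0, 1}`. -/
def SymFun (m : ℕ) : Type :=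
  {f : Fin m → Fin m → Bool // ∀ i j, f i j = f j i}

/-- `G` is a (finite) `m`-partite cograph: there is a finite rooted tree `T` (ordered by the
ancestor relation, the root being `⊥` and `⊓` being the least common ancestor) whose leaves are in
bijection with the vertices of `G`, a labelling of the leaves by `m` labels, and an
assignment of symmetric functions `f` to the nodes of `T`, such that distinct vertices with labels
`i`, `j` are adjacent iff the function at their least common ancestor takes the value `1` at
`(i, j)`. The least common ancestor of distinct leaves is an internal node, so the functions
assigned to leaves play no role. -/
def IsMPartiteCograph (m : ℕ) {V : Type u} (G : SimpleGraph V) : Prop :=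
  ∃ (T : RootedTree.{0}) (_ : Finite T) (leaf : V ≃ {t : T // IsMax t})
    (label : V → Fin m) (f : T → SymFun m),
    ∀ x y : V, x ≠ y →
      (G.Adj x y ↔
        (f ((leaf x : T) ⊓ (leaf y : T))).1 (label x) (label y) = true)

/-! ### Borel graphs and limits -/

/-- A Borel graph with a probability measure: the vertex set is a standard Borel space, the edge
set is a Borel subset of its square. -/
structure BorelGraph where
  /-- The vertex set. -/
  V : Type u
  [measurableSpace : MeasurableSpace V]
  [standardBorelSpace : StandardBorelSpace V]
  /-- The underlying graph. -/
  graph : SimpleGraph V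
  measurableSet_adj : MeasurableSet {e : V × V | graph.Adj e.1 e.2}
  /-- The probability measure on the vertex set. -/
  ν : Measure V
  [isProbabilityMeasure : IsProbabilityMeasure ν]

attribute [instance] BorelGraph.measurableSpace BorelGraph.standardBorelSpace
  BorelGraph.isProbabilityMeasure

namespace BorelGraph

/-- The homomorphism density `t(F, H)`: the probability that independent `ν`-random vertices form
a homomorphic image of `F`. -/
noncomputable def homDensity (H : BorelGraph.{u}) {p : ℕ} (F : SimpleGraph (Fin p)) : ℝ :=
  (Measure.pi fun _ : Fin p => H.ν).real
    {x : Fin p → H.V | ∀ i j, F.Adj i j → H.graph.Adj (x i) (x j)}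

/-- The Stone pairing `⟨φ, H⟩`, the `ν ^ p`-measure of `φ(H)`. -/
noncomputable def stonePairing (H : BorelGraph.{u}) {p : ℕ}
    (φ : FirstOrder.Language.graph.Formula (Fin p)) : ℝ :=
  (Measure.pi fun _ : Fin p => H.ν).real (formulaSet φ H.graph)

/-- `H` is the left limit of the sequence `G` of finite graphs. -/
def IsLeftLimit (H : BorelGraph.{u}) {V : ℕ → Type v} (G : ∀ n, SimpleGraph (V n)) : Prop :=
  ∀ (p : ℕ) (F : SimpleGraph (Fin p)),
    Tendsto (fun n => _root_.homDensity F (G n)) atTop (𝓝 (H.homDensity F))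

/-- `H` is the QF-limit of the sequence `G` of finite graphs. -/
def IsQFLimit (H : BorelGraph.{u}) {V : ℕ → Type v} (G : ∀ n, SimpleGraph (V n)) : Prop :=
  ∀ (p : ℕ) (φ : FirstOrder.Language.graph.Formula (Fin p)), φ.IsQF →
    Tendsto (fun n => _root_.stonePairing φ (G n)) atTop (𝓝 (H.stonePairing φ))

end BorelGraph

/-! ### Colored Borel tree-semilattices and their interpretations -/

/-- A colored Borel tree-semilattice with unary relations indexed by `ι`: a meet semilattice in
which any two elements with a common upper bound are comparable, on a standard Borel space (given
as the Borel space of a Polish topology, so that measures on it have a support), with Borel meet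
operation and Borel unary relations. The topology and the order need not be related otherwise. -/
structure ColoredBorelTreeSemilattice (ι : Type) where
  /-- The domain. -/
  T : Type u
  [semilatticeInf : SemilatticeInf T]
  [topologicalSpace : TopologicalSpace T]
  [polishSpace : PolishSpace T]
  [measurableSpace : MeasurableSpace T]
  [borelSpace : BorelSpace T]
  tree : ∀ x y z : T, x ⊓ z = x → y ⊓ z = y → x ⊓ y = x ∨ x ⊓ y = y
  measurable_inf : Measurable fun e : T × T => e.1 ⊓ e.2
  /-- The unary relations. -/
  rel : ι → Set T
  measurableSet_rel : ∀ s, MeasurableSet (rel s)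

attribute [instance] ColoredBorelTreeSemilattice.semilatticeInf
  ColoredBorelTreeSemilattice.topologicalSpace ColoredBorelTreeSemilattice.polishSpace
  ColoredBorelTreeSemilattice.measurableSpace ColoredBorelTreeSemilattice.borelSpace

/-- The indices of the colors used by cotrees: the `m` labels of leaves and the symmetric functions
assigned to internal nodes. -/
abbrev Palette (m : ℕ) : Type := Fin m ⊕ SymFun m

namespace ColoredBorelTreeSemilattice

/-- The color of an element: the set of indices of the unary relations to which it belongs. -/
def color {ι : Type} (A : ColoredBorelTreeSemilattice.{u} ι) (x : A.T) : Set ι :=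
  {s | x ∈ A.rel s}

/-- `x` has color `s`, that is, `s` is the one index in the color of `x`. -/
def HasColor {ι : Type} (A : ColoredBorelTreeSemilattice.{u} ι) (x : A.T) (s : ι) : Prop :=
  A.color x = {s}

theorem measurableSet_hasColor {ι : Type} [Countable ι] (A : ColoredBorelTreeSemilattice.{u} ι)
    (s : ι) : MeasurableSet {x | A.HasColor x s} := by
  have h : {x | A.HasColor x s} = ⋂ t : ι, {x | x ∈ A.rel t ↔ t = s} := by
    ext x
    simp [HasColor, color, Set.ext_iff]
  rw [h]
  refine MeasurableSet.iInter fun t => ?_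
  by_cases hts : t = s
  · simp only [hts, iff_true]
    exact A.measurableSet_rel s
  · simp only [hts, iff_false]
    exact (A.measurableSet_rel t).compl

/-- Adjacency in the interpretation: `x` has color `i`, `y` has color `j` and `x ⊓ y` has color `f`
for some labels `i`, `j` and some symmetric function `f` with `f (i, j) = 1`. -/
def InterpAdj {m : ℕ} (A : ColoredBorelTreeSemilattice.{u} (Palette m)) (x y : A.T) : Prop :=
  ∃ (i j : Fin m) (f : SymFun m), f.1 i j = true ∧
    A.HasColor x (Sum.inl i) ∧ A.HasColor y (Sum.inl j) ∧ A.HasColor (x ⊓ y) (Sum.inr f)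

theorem InterpAdj.symm {m : ℕ} {A : ColoredBorelTreeSemilattice.{u} (Palette m)} {x y : A.T}
    (h : A.InterpAdj x y) : A.InterpAdj y x := by
  obtain ⟨i, j, f, hf, hx, hy, hxy⟩ := h
  exact ⟨j, i, f, (f.2 j i).trans hf, hy, hx, inf_comm x y ▸ hxy⟩

theorem not_interpAdj_self {m : ℕ} (A : ColoredBorelTreeSemilattice.{u} (Palette m)) (x : A.T) :
    ¬ A.InterpAdj x x := by
  rintro ⟨i, j, f, -, hx, -, hxx⟩
  rw [inf_idem] at hxx
  have h : ({Sum.inl i} : Set (Palette m)) = {Sum.inr f} := hx.symm.trans hxx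
  simp at h

instance (m : ℕ) : Finite (SymFun m) := by
  unfold SymFun
  infer_instance

theorem measurableSet_interpAdj {m : ℕ} (A : ColoredBorelTreeSemilattice.{u} (Palette m)) :
    MeasurableSet {e : A.T × A.T | A.InterpAdj e.1 e.2} := by
  have h : {e : A.T × A.T | A.InterpAdj e.1 e.2} =
      ⋃ (i : Fin m) (j : Fin m) (f : SymFun m) (_ : f.1 i j = true),
        Prod.fst ⁻¹' {x | A.HasColor x (Sum.inl i)} ∩ (Prod.snd ⁻¹' {x | A.HasColor x (Sum.inl j)} ∩
          (fun e : A.T × A.T => e.1 ⊓ e.2) ⁻¹' {x | A.HasColor x (Sum.inr f)}) := by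
    ext e
    simp only [InterpAdj, Set.mem_iUnion, exists_prop]
    rfl
  rw [h]
  exact MeasurableSet.iUnion fun i => MeasurableSet.iUnion fun j => MeasurableSet.iUnion fun f =>
    MeasurableSet.iUnion fun _ => (measurable_fst (A.measurableSet_hasColor _)).inter
      ((measurable_snd (A.measurableSet_hasColor _)).inter
        (A.measurable_inf (A.measurableSet_hasColor _)))

theorem isProbabilityMeasure_comap_support {ι : Type} (A : ColoredBorelTreeSemilattice.{u} ι)
    (μ : Measure A.T) [IsProbabilityMeasure μ] :
    IsProbabilityMeasure (μ.comap ((↑) : μ.support → A.T)) := by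
  constructor
  rw [comap_subtype_coe_apply Measure.isClosed_support.measurableSet, Set.image_univ,
    Subtype.range_coe_subtype, Set.ofPred_mem_eq]
  exact (prob_compl_eq_zero_iff Measure.isClosed_support.measurableSet).1
    Measure.measure_compl_support

/-- The interpretation `I(T, μ)`: the Borel graph whose vertex set is the support of `μ`, with the
restriction of `μ` to its support, where adjacency is decided by the colors of `x`, `y` and
`x ⊓ y`. -/
noncomputable def interp {m : ℕ} (A : ColoredBorelTreeSemilattice.{u} (Palette m))
    (μ : Measure A.T) [IsProbabilityMeasure μ] : BorelGraph.{u} where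
  V := μ.support
  standardBorelSpace := Measure.isClosed_support.measurableSet.standardBorel
  graph :=
    { Adj := fun x y => A.InterpAdj x y
      symm := ⟨fun _ _ h => h.symm⟩
      loopless := ⟨fun x => A.not_interpAdj_self x⟩ }
  measurableSet_adj :=
    (measurable_subtype_coe.prodMap measurable_subtype_coe) A.measurableSet_interpAdj
  ν := μ.comap ((↑) : μ.support → A.T)
  isProbabilityMeasure := A.isProbabilityMeasure_comap_support μ

end ColoredBorelTreeSemilattice

/-! ### Product measures -/

/-! For the converse, sample finitely many points of the tree-semilattice. Elements below a common
element are comparable, so the sets of colored sample points above the meets of two of them form a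
laminar family, and this family is a cotree of the sampled graph (`isMPartiteCograph_sample`). A
second moment bound (`integral_sq_sampleDensity_sub_le`) yields samples whose homomorphism densities
converge to those of the interpretation.

For the direct part, cotrees of unbounded depth are compressed. Assign to a vertex and each `j` its
least ancestor carrying at most a fraction `2⁻ʲ` of the leaves. At the first `j` where these nodes
differ for `x` and `y`, their parents are comparable: otherwise two disjoint leaf sets, each of more
than a fraction `2⁻ʲ`, would lie above a node with at most a fraction `2 * 2⁻ʲ`. So the least common
ancestor is the parent closer to the root (`inf_eq_pred_level`), and a vertex can be coded by a
sequence of letters such that the smaller letter at the first difference decides adjacency. Turning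
keys into ranks in `[1/2, 1]` maps all the graphs into the leaves of one tree-semilattice `codeTree`
on a compact space, where the uniform measures have a weak limit.

Adjacency of codes need not be clopen, but it is clopen relative to a closed set of pairs that
differ by `δ` at an early place, and such pairs have almost full measure uniformly in `n`. Hence
densities pass to the limit (`tendsto_measureReal_relHomSet`). These closed sets avoid the diagonal,
so the limit is atomless; replacing vertices of the `n`-th graph by `n + 1` copies ensures this even
for bounded orders.

QF-limits then come for free: on injective tuples a quantifier-free formula sees only the induced
graph, induced densities follow from homomorphism densities by inversion, and non-injective tuples
are negligible. -/

theorem Measure.pi_map_comp_injective {X ι κ : Type*} [Fintype ι] [Fintype κ] [MeasurableSpace X]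
    (ν : Measure X) [IsProbabilityMeasure ν] {σ : κ → ι} (hσ : σ.Injective) :
    (Measure.pi fun _ : ι => ν).map (fun x k => x (σ k)) = Measure.pi fun _ : κ => ν := by
  have h : ProbabilityTheory.iIndepFun (fun (i : ι) (x : ι → X) => x i)
      (Measure.pi fun _ : ι => ν) :=
    ProbabilityTheory.iIndepFun_pi (X := fun _ => id) (fun _ => aemeasurable_id)
  have h2 := h.precomp hσ
  rw [ProbabilityTheory.iIndepFun_iff_map_fun_eq_pi_map
    (fun k => (measurable_pi_apply (σ k)).aemeasurable)] at h2
  refine h2.trans ?_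
  congr 1
  funext k
  exact (measurePreserving_eval (fun _ : ι => ν) (σ k)).map_eq

theorem Measure.pi_map_pair {X ι : Type*} [Fintype ι] [MeasurableSpace X]
    (ν : Measure X) [IsProbabilityMeasure ν] {i j : ι} (hij : i ≠ j) :
    (Measure.pi fun _ : ι => ν).map (fun x => (x i, x j)) = ν.prod ν := by
  have h : ProbabilityTheory.iIndepFun (fun (i : ι) (x : ι → X) => x i)
      (Measure.pi fun _ : ι => ν) :=
    ProbabilityTheory.iIndepFun_pi (X := fun _ => id) (fun _ => aemeasurable_id)
  have h2 := h.indepFun hij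
  rw [ProbabilityTheory.indepFun_iff_map_prod_eq_prod_map_map
    (measurable_pi_apply i).aemeasurable (measurable_pi_apply j).aemeasurable] at h2
  refine h2.trans ?_
  rw [(measurePreserving_eval (fun _ : ι => ν) i).map_eq,
    (measurePreserving_eval (fun _ : ι => ν) j).map_eq]

theorem measureReal_pi_pair {X ι : Type*} [Fintype ι] [MeasurableSpace X]
    (ν : Measure X) [IsProbabilityMeasure ν] {i j : ι} (hij : i ≠ j) {S : Set (X × X)}
    (hS : MeasurableSet S) :
    (Measure.pi fun _ : ι => ν).real {x | (x i, x j) ∈ S} = (ν.prod ν).real S := by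
  rw [← Measure.pi_map_pair ν hij, map_measureReal_apply (by fun_prop) hS]
  rfl

theorem measureReal_exists_pair_le {X ι : Type*} [Fintype ι] [MeasurableSpace X]
    (ν : Measure X) [IsProbabilityMeasure ν] {S : Set (X × X)} (hS : MeasurableSet S) :
    (Measure.pi fun _ : ι => ν).real {x | ∃ i j, i ≠ j ∧ (x i, x j) ∈ S} ≤
      (Fintype.card ι : ℝ) ^ 2 * (ν.prod ν).real S := by
  have h : {x : ι → X | ∃ i j, i ≠ j ∧ (x i, x j) ∈ S} ⊆
      ⋃ e ∈ (Finset.univ : Finset (ι × ι)), {x | e.1 ≠ e.2 ∧ (x e.1, x e.2) ∈ S} := by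
    rintro x ⟨i, j, hij, hx⟩
    simp only [Set.mem_iUnion]
    exact ⟨(i, j), Finset.mem_univ _, hij, hx⟩
  refine (measureReal_mono h (measure_ne_top _ _)).trans ((measureReal_biUnion_finset_le _ _).trans ?_)
  refine (Finset.sum_le_card_nsmul _ _ ((ν.prod ν).real S) fun e _ => ?_).trans ?_
  · by_cases he : e.1 = e.2
    · simp [he]
    · simp only [ne_eq, he, not_false_eq_true, true_and]
      exact (measureReal_pi_pair ν he hS).le
  · simp [sq]

/-- Union bound over pairs of coordinates. The diagonal has measure `0` for an atomless measure and
`1 / N` for the uniform measure on `N` points. -/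
theorem measureReal_not_injective_le {X ι : Type*} [Fintype ι] [MeasurableSpace X]
    (ν : Measure X) [IsProbabilityMeasure ν] (hd : MeasurableSet (Set.diagonal X)) :
    (Measure.pi fun _ : ι => ν).real {x | ¬ x.Injective} ≤
      (Fintype.card ι : ℝ) ^ 2 * (ν.prod ν).real (Set.diagonal X) := by
  refine le_trans (measureReal_mono ?_) (measureReal_exists_pair_le ν hd)
  intro x hx
  simp only [Set.mem_ofPred_eq, Function.Injective, not_forall] at hx
  obtain ⟨i, j, h, hij⟩ := hx
  exact ⟨i, j, hij, h⟩

theorem prod_diagonal_of_atomless {X : Type*} [MeasurableSpace X]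
    (ν : Measure X) [IsProbabilityMeasure ν] (hd : MeasurableSet (Set.diagonal X))
    (h0 : ∀ x, ν {x} = 0) : (ν.prod ν).real (Set.diagonal X) = 0 := by
  rw [measureReal_def, Measure.prod_apply hd]
  have : ∀ x : X, Prod.mk x ⁻¹' Set.diagonal X = {x} := by
    intro x
    ext y
    simp [eq_comm]
  simp [this, h0]

/-! ### Uniform measures on finite sets -/

section Uniform

variable {V : Type*} [Finite V] [MeasurableSpace V] [MeasurableSingletonClass V]

/-- The uniform probability measure on a finite set. -/
noncomputable def uniformMeasure (V : Type*) [MeasurableSpace V] : Measure V :=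
  ProbabilityTheory.uniformOn Set.univ

instance [Nonempty V] : IsProbabilityMeasure (uniformMeasure V) :=
  ⟨ProbabilityTheory.uniformOn_of_univ Set.finite_univ Set.univ_nonempty⟩

theorem uniformMeasure_real (S : Set V) :
    (uniformMeasure V).real S = (Nat.card S : ℝ) / Nat.card V := by
  have := Fintype.ofFinite V
  rw [measureReal_def, uniformMeasure, ProbabilityTheory.uniformOn_univ,
    Measure.count_apply_finite _ S.toFinite, ENNReal.toReal_div]
  simp [← Nat.card_eq_card_finite_toFinset]

variable [Nonempty V]

theorem pi_uniformMeasure_real {ι : Type*} [Fintype ι] (S : Set (ι → V)) :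
    (Measure.pi fun _ : ι => uniformMeasure V).real S =
      (Nat.card S : ℝ) / (Nat.card V : ℝ) ^ Fintype.card ι := by
  have h1 : ∀ x : ι → V, (Measure.pi fun _ : ι => uniformMeasure V).real {x} =
      1 / (Nat.card V : ℝ) ^ Fintype.card ι := by
    intro x
    rw [measureReal_def, Measure.pi_singleton, ENNReal.toReal_prod]
    have : ∀ i, ((uniformMeasure V) {x i}).toReal = 1 / (Nat.card V : ℝ) := by
      intro i
      have := uniformMeasure_real ({x i} : Set V)
      rw [measureReal_def] at this
      simpa using this
    simp [this]
  have hS := S.toFinite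
  rw [← hS.coe_toFinset, ← sum_measureReal_singleton]
  simp only [h1]
  rw [Finset.sum_const, nsmul_eq_mul, Nat.card_coe_set_eq, Set.ncard_coe_finset]
  ring

theorem uniformMeasure_prod_real (S : Set (V × V)) :
    ((uniformMeasure V).prod (uniformMeasure V)).real S =
      (Nat.card S : ℝ) / (Nat.card V : ℝ) ^ 2 := by
  have hS := S.toFinite
  rw [← hS.coe_toFinset, ← sum_measureReal_singleton]
  have h1 : ∀ x : V × V, ((uniformMeasure V).prod (uniformMeasure V)).real {x} =
      1 / (Nat.card V : ℝ) ^ 2 := by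
    rintro ⟨x, y⟩
    rw [← Set.singleton_prod_singleton, measureReal_prod_prod, uniformMeasure_real,
      uniformMeasure_real]
    simp [sq]
  simp only [h1]
  rw [Finset.sum_const, nsmul_eq_mul, Nat.card_coe_set_eq, Set.ncard_coe_finset]
  ring

theorem uniformMeasure_prod_diagonal :
    ((uniformMeasure V).prod (uniformMeasure V)).real (Set.diagonal V) = 1 / Nat.card V := by
  rw [uniformMeasure_prod_real]
  have : Nat.card (Set.diagonal V) = Nat.card V :=
    Nat.card_congr ⟨fun x => x.1.1, fun x => ⟨(x, x), rfl⟩,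
      by rintro ⟨⟨x, y⟩, h : x = y⟩; subst h; rfl, fun _ => rfl⟩
  have hV : (Nat.card V : ℝ) ≠ 0 := by
    exact_mod_cast Nat.card_pos.ne'
  rw [this]
  field_simp

end Uniform

/-! ### Homomorphism densities and Stone pairings as probabilities -/

/-- The set of homomorphisms from `F` to `G`, as tuples. -/
def homSet {V : Type u} {p : ℕ} (F : SimpleGraph (Fin p)) (G : SimpleGraph V) : Set (Fin p → V) :=
  {x | ∀ i j, F.Adj i j → G.Adj (x i) (x j)}

theorem mem_homSet {V : Type u} {p : ℕ} {F : SimpleGraph (Fin p)} {G : SimpleGraph V}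
    {x : Fin p → V} : x ∈ homSet F G ↔ F ≤ G.comap x :=
  Iff.rfl

section FiniteDensity

variable {V : Type u} [Finite V] [Nonempty V] [MeasurableSpace V] [MeasurableSingletonClass V]

theorem homDensity_eq_measureReal {p : ℕ} (F : SimpleGraph (Fin p)) (G : SimpleGraph V) :
    homDensity F G = (Measure.pi fun _ : Fin p => uniformMeasure V).real (homSet F G) := by
  rw [pi_uniformMeasure_real, homDensity]
  have : Nat.card (F →g G) = Nat.card (homSet F G) :=
    Nat.card_congr ⟨fun f => ⟨f, fun _ _ h => f.map_rel h⟩, fun x => ⟨x.1, fun h => x.2 _ _ h⟩,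
      fun _ => rfl, fun _ => rfl⟩
  simp [this]

theorem stonePairing_eq_measureReal {p : ℕ} (φ : FirstOrder.Language.graph.Formula (Fin p))
    (G : SimpleGraph V) :
    stonePairing φ G =
      (Measure.pi fun _ : Fin p => uniformMeasure V).real (formulaSet φ G) := by
  rw [pi_uniformMeasure_real, stonePairing, Fintype.card_fin]

end FiniteDensity

/-! ### Quantifier-free formulas and induced subgraphs -/

section Induced

variable {V : Type u} {p : ℕ}

/-- An injective tuple is an embedding of the pulled-back graph, and embeddings preserve and reflect
quantifier-free formulas. Injectivity is needed for the equality atoms. -/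
theorem mem_formulaSet_iff_of_injective {φ : FirstOrder.Language.graph.Formula (Fin p)}
    (hφ : φ.IsQF) (G : SimpleGraph V) {x : Fin p → V} (hx : x.Injective) :
    x ∈ formulaSet φ G ↔ id ∈ formulaSet φ (G.comap x) := by
  let := G.structure
  let := (G.comap x).structure
  let f : FirstOrder.Language.Embedding FirstOrder.Language.graph (Fin p) V :=
    { toFun := x
      inj' := hx
      map_fun' := fun f => isEmptyElim f
      map_rel' := fun {n} r y => by cases r; rfl }
  have h := FirstOrder.Language.BoundedFormula.IsQF.realize_embedding hφ f
    (v := (id : Fin p → Fin p)) (xs := default)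
  simp only [formulaSet, Set.mem_ofPred_eq, FirstOrder.Language.Formula.Realize]
  rw [← h]
  have e1 : (f ∘ id : Fin p → V) = x := rfl
  rw [e1, Unique.eq_default (f ∘ default)]

variable [MeasurableSpace V] {G : SimpleGraph V}

theorem measurableSet_homSet (hG : MeasurableSet {e : V × V | G.Adj e.1 e.2})
    (F : SimpleGraph (Fin p)) : MeasurableSet (homSet F G) := by
  have : homSet F G = ⋂ (i) (j) (_ : F.Adj i j),
      (fun x : Fin p → V => (x i, x j)) ⁻¹' {e : V × V | G.Adj e.1 e.2} := by
    ext x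
    simp [homSet]
  rw [this]
  exact MeasurableSet.iInter fun i => MeasurableSet.iInter fun j => MeasurableSet.iInter fun _ =>
    hG.preimage (by fun_prop)

theorem measurableSet_comap_eq (hG : MeasurableSet {e : V × V | G.Adj e.1 e.2})
    (F : SimpleGraph (Fin p)) : MeasurableSet {x : Fin p → V | G.comap x = F} := by
  -- Inducing exactly `F` means being a homomorphism from `F` but from no graph with more edges.
  have : {x : Fin p → V | G.comap x = F} =
      homSet F G \ ⋃ F' ∈ Set.Ioi F, homSet F' G := by
    ext x
    simp only [Set.mem_ofPred_eq, Set.mem_sdiff, Set.mem_iUnion, mem_homSet, Set.mem_Ioi,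
      exists_prop, not_exists, not_and]
    constructor
    · rintro rfl
      exact ⟨le_rfl, fun F' h1 h2 => (h1.trans_le h2).false⟩
    · rintro ⟨h1, h2⟩
      by_contra h
      exact h2 _ (lt_of_le_of_ne h1 (Ne.symm h)) le_rfl
  rw [this]
  exact (measurableSet_homSet hG F).diff
    (MeasurableSet.biUnion (Set.to_countable _) fun F' _ => measurableSet_homSet hG F')

theorem measureReal_comap_mem (ν : Measure V) [IsProbabilityMeasure ν]
    (hG : MeasurableSet {e : V × V | G.Adj e.1 e.2}) (S : Finset (SimpleGraph (Fin p))) :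
    (Measure.pi fun _ : Fin p => ν).real {x | G.comap x ∈ S} =
      ∑ F ∈ S, (Measure.pi fun _ : Fin p => ν).real {x | G.comap x = F} := by
  rw [← measureReal_biUnion_finset]
  · congr 1
    ext x
    simp
  · intro F _ F' _ h
    refine Set.disjoint_left.2 fun x hx hx' => h ?_
    exact hx.symm.trans hx'
  · exact fun F _ => measurableSet_comap_eq hG F

open Classical in
/-- The graphs on `Fin p` in which the identity tuple satisfies `φ`. -/
noncomputable def satGraphs (φ : FirstOrder.Language.graph.Formula (Fin p)) :
    Finset (SimpleGraph (Fin p)) :=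
  Finset.univ.filter fun F => id ∈ formulaSet φ F

theorem abs_measureReal_sub_le_of_subset_union {α : Type*} [MeasurableSpace α] (μ : Measure α)
    [IsFiniteMeasure μ] {A B C : Set α} (h1 : A ⊆ B ∪ C) (h2 : B ⊆ A ∪ C) :
    |μ.real A - μ.real B| ≤ μ.real C := by
  have h3 := (measureReal_mono (μ := μ) h1).trans (measureReal_union_le _ _)
  have h4 := (measureReal_mono (μ := μ) h2).trans (measureReal_union_le _ _)
  rw [abs_le]
  constructor <;> linarith

/-- Up to repeated coordinates, `φ` is a finite disjunction of conditions on the induced graph; only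
non-injective tuples contribute to the error. -/
theorem abs_formulaSet_sub_le (ν : Measure V) [IsProbabilityMeasure ν]
    (hd : MeasurableSet (Set.diagonal V)) {φ : FirstOrder.Language.graph.Formula (Fin p)}
    (hφ : φ.IsQF) (G : SimpleGraph V) :
    |(Measure.pi fun _ : Fin p => ν).real (formulaSet φ G) -
      (Measure.pi fun _ : Fin p => ν).real {x | G.comap x ∈ satGraphs φ}| ≤
      (p : ℝ) ^ 2 * (ν.prod ν).real (Set.diagonal V) := by
  have key : ∀ x : Fin p → V, x.Injective → (x ∈ formulaSet φ G ↔ G.comap x ∈ satGraphs φ) := by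
    intro x hx
    simp [satGraphs, mem_formulaSet_iff_of_injective hφ G hx]
  have hle := measureReal_not_injective_le (ι := Fin p) ν hd
  rw [Fintype.card_fin] at hle
  refine (abs_measureReal_sub_le_of_subset_union _ (C := {x | ¬ x.Injective}) ?_ ?_).trans hle
  · intro x hx
    by_cases h : x.Injective
    · exact Or.inl ((key x h).1 hx)
    · exact Or.inr h
  · intro x hx
    by_cases h : x.Injective
    · exact Or.inl ((key x h).2 hx)
    · exact Or.inr h

end Induced

-- Möbius inversion by downward induction: a value is its sum over the upper set minus the sum over
-- the strict upper set, whose terms already converge.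
open Classical in
theorem tendsto_of_tendsto_sum_Ici {P : Type*} [Fintype P] [PartialOrder P]
    {a : ℕ → P → ℝ} {b : P → ℝ}
    (h : ∀ F, Tendsto (fun n => ∑ F' with F ≤ F', a n F') atTop
      (𝓝 (∑ F' with F ≤ F', b F'))) (F : P) :
    Tendsto (fun n => a n F) atTop (𝓝 (b F)) := by
  induction F using WellFoundedGT.induction with
  | ind F ih =>
    have e : ∀ c : P → ℝ, c F = ∑ F' with F ≤ F', c F' - ∑ F' with F < F', c F' := by
      intro c
      have : (Finset.univ.filter fun F' => F ≤ F') =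
          insert F (Finset.univ.filter fun F' => F < F') := by
        ext x
        simp [le_iff_eq_or_lt, eq_comm]
      rw [this, Finset.sum_insert (by simp)]
      ring
    rw [e b]
    simp only [e (a _)]
    exact (h F).sub (tendsto_finsetSum _ fun F' hF' => ih F' (Finset.mem_filter.1 hF').2)

theorem BorelGraph.homDensity_eq (H : BorelGraph.{u}) {p : ℕ} (F : SimpleGraph (Fin p)) :
    H.homDensity F = (Measure.pi fun _ : Fin p => H.ν).real (homSet F H.graph) :=
  rfl

/-- An atomless left limit of a sequence of graphs whose orders tend to infinity is also the
QF-limit. -/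
theorem BorelGraph.IsLeftLimit.isQFLimit {H : BorelGraph.{u}} {V : ℕ → Type v}
    {G : ∀ n, SimpleGraph (V n)} (hfin : ∀ n, Finite (V n)) (hne : ∀ n, Nonempty (V n))
    (hH : H.IsLeftLimit G) (h0 : ∀ x, H.ν {x} = 0)
    (hV : Tendsto (fun n => Nat.card (V n)) atTop atTop) : H.IsQFLimit G := by
  classical
  intro p φ hφ
  let : ∀ n, MeasurableSpace (V n) := fun n => ⊤
  have : ∀ n, MeasurableSingletonClass (V n) := fun n => ⟨fun _ => trivial⟩
  have hm : ∀ n, MeasurableSet {e : V n × V n | (G n).Adj e.1 e.2} := fun n =>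
    (Set.toFinite _).measurableSet
  have hind : ∀ F : SimpleGraph (Fin p), Tendsto (fun n =>
      (Measure.pi fun _ : Fin p => uniformMeasure (V n)).real {x | (G n).comap x = F}) atTop
      (𝓝 ((Measure.pi fun _ : Fin p => H.ν).real {x | H.graph.comap x = F})) := by
    -- The homomorphism density of `F` is the sum of the induced densities of all `F' ≥ F`.
    refine tendsto_of_tendsto_sum_Ici fun F => ?_
    simp only [← measureReal_comap_mem _ (hm _), ← measureReal_comap_mem _ H.measurableSet_adj]
    have := hH p F
    simp only [homDensity_eq_measureReal, BorelGraph.homDensity_eq] at this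
    simp only [Finset.mem_filter, Finset.mem_univ, true_and]
    exact this
  have hsat := tendsto_finsetSum (satGraphs φ) fun F _ => hind F
  simp only [← measureReal_comap_mem _ (hm _), ← measureReal_comap_mem _ H.measurableSet_adj]
    at hsat
  have hHeq : H.stonePairing φ =
      (Measure.pi fun _ : Fin p => H.ν).real {x | H.graph.comap x ∈ satGraphs φ} := by
    have := abs_formulaSet_sub_le H.ν measurableSet_diagonal hφ H.graph
    rw [prod_diagonal_of_atomless H.ν measurableSet_diagonal h0, mul_zero] at this
    exact sub_eq_zero.1 (abs_nonpos_iff.1 this)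
  rw [hHeq]
  have hdiff : Tendsto (fun n => _root_.stonePairing φ (G n) -
      (Measure.pi fun _ : Fin p => uniformMeasure (V n)).real
        {x | (G n).comap x ∈ satGraphs φ}) atTop (𝓝 0) := by
    refine squeeze_zero_norm (a := fun n => (p : ℝ) ^ 2 * (1 / (Nat.card (V n) : ℝ)))
      (fun n => ?_) ?_
    · rw [stonePairing_eq_measureReal, Real.norm_eq_abs, ← uniformMeasure_prod_diagonal]
      exact abs_formulaSet_sub_le _ (Set.toFinite _).measurableSet hφ _
    · have := (tendsto_const_div_atTop_nhds_zero_nat (1 : ℝ)).comp hV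
      simpa using this.const_mul ((p : ℝ) ^ 2)
  simpa using hdiff.add hsat

/-! ### Finite rooted trees and laminar families -/

section FiniteTree

variable {α : Type u} [PartialOrder α] [Finite α]

/-- A maximal common lower bound is greatest, because all common lower bounds lie below `a` and so
form a chain. -/
theorem exists_isGLB_pair_of_chain [OrderBot α]
    (h : ∀ x y z : α, x ≤ z → y ≤ z → x ≤ y ∨ y ≤ x) (a b : α) :
    ∃ c, c ≤ a ∧ c ≤ b ∧ ∀ d, d ≤ a → d ≤ b → d ≤ c := by
  obtain ⟨c, hc⟩ := (Set.toFinite {c | c ≤ a ∧ c ≤ b}).exists_maximal ⟨⊥, bot_le, bot_le⟩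
  refine ⟨c, hc.1.1, hc.1.2, fun d hda hdb => ?_⟩
  rcases h d c a hda hc.1.1 with h' | h'
  · exact h'
  · exact hc.2 ⟨hda, hdb⟩ h'

/-- The predecessor is a maximal element strictly below `a`, unique as these form a chain; a minimal
element is its own predecessor. -/
theorem exists_pred_of_chain (h : ∀ x y z : α, x ≤ z → y ≤ z → x ≤ y ∨ y ≤ x) (a : α) :
    ∃ c, c ≤ a ∧ (a ≤ c → IsMin a) ∧ ∀ b, b < a → b ≤ c := by
  by_cases ha : IsMin a
  · exact ⟨a, le_rfl, fun _ => ha, fun b hb => hb.le⟩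
  · obtain ⟨b, hb⟩ := not_isMin_iff.1 ha
    obtain ⟨c, hc⟩ := (Set.toFinite {c | c < a}).exists_maximal ⟨b, hb⟩
    refine ⟨c, hc.1.le, fun hac => absurd hc.1 hac.not_gt, fun d hd => ?_⟩
    rcases h d c a hd.le hc.1.le with h' | h'
    · exact h'
    · exact hc.2 hd h'

/-- A finite partial order with a least element in which lower sets of elements are chains, as a
rooted tree. -/
noncomputable def RootedTree.ofFinite (α : Type u) [PartialOrder α] [Finite α] [OrderBot α]
    (h : ∀ x y z : α, x ≤ z → y ≤ z → x ≤ y ∨ y ≤ x) : RootedTree.{u} :=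
  letI : PredOrder α :=
    { pred := fun a => (exists_pred_of_chain h a).choose
      pred_le := fun a => (exists_pred_of_chain h a).choose_spec.1
      min_of_le_pred := fun {a} => (exists_pred_of_chain h a).choose_spec.2.1
      le_pred_of_lt := fun {a b} hab => (exists_pred_of_chain h b).choose_spec.2.2 a hab }
  { α := α
    semilatticeInf :=
      { ‹PartialOrder α› with
        inf := fun a b => (exists_isGLB_pair_of_chain h a b).choose
        inf_le_left := fun a b => (exists_isGLB_pair_of_chain h a b).choose_spec.1
        inf_le_right := fun a b => (exists_isGLB_pair_of_chain h a b).choose_spec.2.1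
        le_inf := fun a b c => (exists_isGLB_pair_of_chain h b c).choose_spec.2.2 a }
    orderBot := ‹OrderBot α›
    predOrder := this
    isPredArchimedean := inferInstance }

end FiniteTree

/-- A graph whose adjacency is decided by a coloring of a laminar family is an `m`-partite
cograph. -/
theorem isMPartiteCograph_of_laminar {m : ℕ} {V : Type} [Finite V] [Nonempty V]
    (G : SimpleGraph V) (𝓕 : Set (Set V)) (huniv : Set.univ ∈ 𝓕) (hne : ∀ A ∈ 𝓕, A.Nonempty)
    (hsing : ∀ v, {v} ∈ 𝓕) (hlam : ∀ A ∈ 𝓕, ∀ B ∈ 𝓕, (A ∩ B).Nonempty → A ⊆ B ∨ B ⊆ A)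
    (label : V → Fin m) (f : Set V → SymFun m)
    (hadj : ∀ x y, x ≠ y → ∀ A ∈ 𝓕, x ∈ A → y ∈ A → (∀ B ∈ 𝓕, x ∈ B → y ∈ B → A ⊆ B) →
      (G.Adj x y ↔ (f A).1 (label x) (label y) = true)) :
    IsMPartiteCograph m G := by
  -- The tree is the family under reverse inclusion: the root is the whole set, the leaves are the
  -- singletons, and the meet of two leaves is the smallest member containing both points.
  let bot : OrderBot (𝓕ᵒᵈ) :=
    { bot := OrderDual.toDual ⟨Set.univ, huniv⟩
      bot_le := fun A => Set.subset_univ (OrderDual.ofDual A).1 }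
  have hchain : ∀ x y z : 𝓕ᵒᵈ, x ≤ z → y ≤ z → x ≤ y ∨ y ≤ x := by
    intro x y z hx hy
    obtain ⟨v, hv⟩ := hne _ (OrderDual.ofDual z).2
    exact (hlam _ (OrderDual.ofDual x).2 _ (OrderDual.ofDual y).2 ⟨v, hx hv, hy hv⟩).symm
  let T : RootedTree.{0} := RootedTree.ofFinite (𝓕ᵒᵈ) hchain
  have hfin : Finite (𝓕ᵒᵈ) := inferInstanceAs (Finite 𝓕)
  let s : V → T := fun v => OrderDual.toDual (⟨{v}, hsing v⟩ : 𝓕)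
  have hle : ∀ A B : 𝓕, (show T from OrderDual.toDual A) ≤ (show T from OrderDual.toDual B) ↔
      B.1 ⊆ A.1 := fun A B => Iff.rfl
  have hmax : ∀ v, IsMax (s v) := by
    intro v A hA x hx
    have hx' : x = v := hx
    subst hx'
    obtain ⟨y, hy⟩ := hne _ (OrderDual.ofDual A).2
    have : y = x := hA hy
    exact this ▸ hy
  refine ⟨T, hfin, Equiv.ofBijective (fun v => ⟨s v, hmax v⟩) ⟨?_, ?_⟩, label,
    fun A => f (OrderDual.ofDual (show 𝓕ᵒᵈ from A)).1, ?_⟩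
  · intro v w h
    have h1 : s v = s w := congrArg Subtype.val h
    have h2 : ({v} : Set V) = {w} := congrArg (fun A : 𝓕ᵒᵈ => (OrderDual.ofDual A).1) h1
    exact Set.singleton_injective h2
  · rintro ⟨A, hA⟩
    obtain ⟨y, hy⟩ := hne _ (OrderDual.ofDual (show 𝓕ᵒᵈ from A)).2
    have h1 : A ≤ s y := by
      intro z hz
      have hz' : z = y := hz
      exact hz' ▸ hy
    refine ⟨y, Subtype.ext (le_antisymm (hA h1) h1)⟩
  · intro x y hxy
    have h1 : s x ⊓ s y ≤ s x := inf_le_left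
    have h2 : s x ⊓ s y ≤ s y := inf_le_right
    let z : T := s x ⊓ s y
    refine hadj x y hxy _ (OrderDual.ofDual (show 𝓕ᵒᵈ from z)).2
      (h1 (Set.mem_singleton x)) (h2 (Set.mem_singleton y)) ?_
    intro B hB hx hy
    have h3 : (show T from OrderDual.toDual (⟨B, hB⟩ : 𝓕)) ≤ s x ⊓ s y := by
      refine le_inf ?_ ?_
      · intro z hz
        have hz' : z = x := hz
        exact hz' ▸ hx
      · intro z hz
        have hz' : z = y := hz
        exact hz' ▸ hy
    exact h3

/-! ### Finite samples of colored tree-semilattices are `m`-partite cographs -/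

theorem ColoredBorelTreeSemilattice.HasColor.unique {ι : Type}
    {A : ColoredBorelTreeSemilattice.{u} ι} {x : A.T} {s t : ι} (hs : A.HasColor x s)
    (ht : A.HasColor x t) : s = t :=
  Set.singleton_injective (hs.symm.trans ht)

theorem ColoredBorelTreeSemilattice.interpAdj_iff {m : ℕ}
    {A : ColoredBorelTreeSemilattice.{u} (Palette m)} {x y : A.T} {i j : Fin m}
    (hx : A.HasColor x (Sum.inl i)) (hy : A.HasColor y (Sum.inl j)) :
    A.InterpAdj x y ↔ ∃ f : SymFun m, A.HasColor (x ⊓ y) (Sum.inr f) ∧ f.1 i j = true := by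
  constructor
  · rintro ⟨i', j', f, hf, hx', hy', hxy⟩
    cases Sum.inl_injective (hx.unique hx')
    cases Sum.inl_injective (hy.unique hy')
    exact ⟨f, hxy, hf⟩
  · rintro ⟨f, hxy, hf⟩
    exact ⟨i, j, f, hf, hx, hy, hxy⟩

theorem ColoredBorelTreeSemilattice.le_or_le {ι : Type} (A : ColoredBorelTreeSemilattice.{u} ι)
    {x y z : A.T} (hx : x ≤ z) (hy : y ≤ z) : x ≤ y ∨ y ≤ x := by
  rcases A.tree x y z (inf_eq_left.2 hx) (inf_eq_left.2 hy) with h | h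
  · exact Or.inl (inf_eq_left.1 h)
  · exact Or.inr (inf_eq_right.1 h)

/-- Two sets `C a b`, `C a' b'` sharing a point `c` come from meets that are both below `x c`, hence
comparable, so the sets are nested. Points without a leaf color are isolated and are kept out of
these sets. -/
theorem isMPartiteCograph_sample {m : ℕ} (hm : 1 ≤ m)
    (A : ColoredBorelTreeSemilattice.{u} (Palette m)) {V : Type} [Finite V] [Nonempty V]
    (x : V → A.T) (G : SimpleGraph V) (hG : ∀ a b, G.Adj a b ↔ A.InterpAdj (x a) (x b)) :
    IsMPartiteCograph m G := by
  classical
  let colored : V → Prop := fun a => ∃ i : Fin m, A.HasColor (x a) (Sum.inl i)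
  let C : V → V → Set V := fun a b => {c | colored c ∧ x a ⊓ x b ≤ x c}
  let label : V → Fin m := fun a => if h : colored a then h.choose else ⟨0, hm⟩
  have hlabel : ∀ a, colored a → A.HasColor (x a) (Sum.inl (label a)) := by
    intro a ha
    simp only [label, ha, dif_pos]
    exact ha.choose_spec
  -- The node function of a set is read off the color of a meet generating it. It is constantly
  -- `false` if there is no such color, in particular when repeated sample points make the meet a
  -- leaf.
  let P : Set V → SymFun m → Prop := fun S g => ∃ a b, colored a ∧ colored b ∧ S = C a b ∧
    A.HasColor (x a ⊓ x b) (Sum.inr g)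
  let f : Set V → SymFun m := fun S => if h : ∃ g, P S g then h.choose else
    ⟨fun _ _ => false, fun _ _ => rfl⟩
  have hCl : ∀ a b, colored a → a ∈ C a b := fun a b ha => ⟨ha, inf_le_left⟩
  have hCr : ∀ a b, colored b → b ∈ C a b := fun a b hb => ⟨hb, inf_le_right⟩
  have hsub : ∀ a b a' b', a ∈ C a' b' → b ∈ C a' b' → x a' ⊓ x b' ≤ x a ⊓ x b :=
    fun a b a' b' ha hb => le_inf ha.2 hb.2
  have hmono : ∀ a b a' b', x a' ⊓ x b' ≤ x a ⊓ x b → C a b ⊆ C a' b' :=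
    fun a b a' b' h c hc => ⟨hc.1, h.trans hc.2⟩
  let 𝓕 : Set (Set V) := {S | S = Set.univ ∨ (∃ v, S = {v}) ∨
    ∃ a b, colored a ∧ colored b ∧ S = C a b}
  refine isMPartiteCograph_of_laminar G 𝓕 (Or.inl rfl) ?_ (fun v => Or.inr (Or.inl ⟨v, rfl⟩)) ?_
    label f ?_
  · rintro S (rfl | ⟨v, rfl⟩ | ⟨a, b, ha, hb, rfl⟩)
    · exact Set.univ_nonempty
    · exact Set.singleton_nonempty v
    · exact ⟨a, hCl a b ha⟩
  · rintro S (rfl | ⟨v, rfl⟩ | ⟨a, b, ha, hb, rfl⟩) S' hS' ⟨c, hc, hc'⟩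
    · exact Or.inr (Set.subset_univ _)
    · rw [Set.mem_singleton_iff] at hc
      subst hc
      exact Or.inl (Set.singleton_subset_iff.2 hc')
    · rcases hS' with rfl | ⟨v, rfl⟩ | ⟨a', b', ha', hb', rfl⟩
      · exact Or.inl (Set.subset_univ _)
      · rw [Set.mem_singleton_iff] at hc'
        subst hc'
        exact Or.inr (Set.singleton_subset_iff.2 hc)
      · rcases A.le_or_le hc.2 hc'.2 with h | h
        · exact Or.inr (hmono _ _ _ _ h)
        · exact Or.inl (hmono _ _ _ _ h)
  · intro a b hab S hS ha hb hmin
    rw [hG]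
    by_cases hcol : colored a ∧ colored b
    · have hSC : S = C a b := by
        refine Set.Subset.antisymm (hmin _ (Or.inr (Or.inr ⟨a, b, hcol.1, hcol.2, rfl⟩))
          (hCl a b hcol.1) (hCr a b hcol.2)) ?_
        rcases hS with rfl | ⟨v, rfl⟩ | ⟨a', b', ha', hb', rfl⟩
        · exact Set.subset_univ _
        · rw [Set.mem_singleton_iff] at ha hb
          exact absurd (ha.trans hb.symm) hab
        · exact hmono _ _ _ _ (hsub _ _ _ _ ha hb)
      -- The set `C a b` determines the meet `x a ⊓ x b`: generators of equal sets lie in each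
      -- other's sets, so the two meets are below one another.
      have huniq : ∀ g, P S g ↔ A.HasColor (x a ⊓ x b) (Sum.inr g) := by
        intro g
        constructor
        · rintro ⟨a', b', ha', hb', hS', hg⟩
          have hCC : C a b = C a' b' := hSC.symm.trans hS'
          have h1 : x a' ⊓ x b' ≤ x a ⊓ x b :=
            hsub _ _ _ _ (hCC ▸ hCl a b hcol.1) (hCC ▸ hCr a b hcol.2)
          have h2 : x a ⊓ x b ≤ x a' ⊓ x b' :=
            hsub _ _ _ _ (hCC ▸ hCl a' b' ha') (hCC ▸ hCr a' b' hb')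
          rwa [le_antisymm h2 h1]
        · exact fun hg => ⟨a, b, hcol.1, hcol.2, hSC, hg⟩
      rw [A.interpAdj_iff (hlabel a hcol.1) (hlabel b hcol.2)]
      by_cases hex : ∃ g, P S g
      · have hf : f S = hex.choose := dif_pos hex
        have hc := (huniq _).1 hex.choose_spec
        rw [hf]
        constructor
        · rintro ⟨g, hg, hgt⟩
          cases Sum.inr_injective (hg.unique hc)
          exact hgt
        · exact fun h => ⟨_, hc, h⟩
      · have hf : f S = ⟨fun _ _ => false, fun _ _ => rfl⟩ := dif_neg hex
        rw [hf]
        simp only [Bool.false_eq_true, iff_false]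
        rintro ⟨g, hg, -⟩
        exact hex ⟨g, (huniq g).2 hg⟩
    -- A set containing an uncolored point is not of the form `C a' b'`, so its function is the
    -- default.
    · have hf : f S = ⟨fun _ _ => false, fun _ _ => rfl⟩ := by
        refine dif_neg ?_
        rintro ⟨g, a', b', -, -, rfl, -⟩
        exact hcol ⟨ha.1, hb.1⟩
      rw [hf]
      simp only [Bool.false_eq_true, iff_false]
      rintro ⟨i, j, -, -, hi, hj, -⟩
      exact hcol ⟨⟨i, hi⟩, ⟨j, hj⟩⟩

/-! ### Random samples from a Borel graph -/

section Sampling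

variable {X ι : Type*} [Fintype ι] {n : ℕ}

/-- The probability that a tuple chosen uniformly from the points `x 0, …, x n` lies in `A`. -/
noncomputable def sampleDensity (A : Set (ι → X)) (x : Fin (n + 1) → X) : ℝ :=
  (Measure.pi fun _ : ι => uniformMeasure (Fin (n + 1))).real {i | (fun k => x (i k)) ∈ A}

open Classical in
theorem sampleDensity_eq_sum (A : Set (ι → X)) (x : Fin (n + 1) → X) :
    sampleDensity A x = ∑ i : ι → Fin (n + 1),
      (Measure.pi fun _ : ι => uniformMeasure (Fin (n + 1))).real {i} *
        A.indicator 1 (fun k => x (i k)) := by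
  rw [sampleDensity]
  have hS := Set.toFinite {i : ι → Fin (n + 1) | (fun k => x (i k)) ∈ A}
  rw [← hS.coe_toFinset, ← sum_measureReal_singleton]
  simp only [Set.indicator_apply, Pi.one_apply, mul_ite, mul_one, mul_zero]
  rw [← Finset.sum_filter]
  congr 1
  ext i
  simp

theorem sampleDensity_nonneg (A : Set (ι → X)) (x : Fin (n + 1) → X) : 0 ≤ sampleDensity A x :=
  measureReal_nonneg

theorem sampleDensity_le_one (A : Set (ι → X)) (x : Fin (n + 1) → X) : sampleDensity A x ≤ 1 :=
  measureReal_le_one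

variable [MeasurableSpace X]

theorem measurable_sampleDensity {A : Set (ι → X)} (hA : MeasurableSet A) :
    Measurable (sampleDensity A : (Fin (n + 1) → X) → ℝ) := by
  rw [funext (sampleDensity_eq_sum (n := n) A)]
  refine Finset.measurable_sum _ fun i _ => Measurable.const_mul ?_ _
  exact (measurable_const.indicator hA).comp (by fun_prop)

variable (ν : Measure X) [IsProbabilityMeasure ν]

theorem integrable_sampleDensity {A : Set (ι → X)} (hA : MeasurableSet A) :
    Integrable (sampleDensity A) (Measure.pi fun _ : Fin (n + 1) => ν) :=
  Integrable.of_bound (measurable_sampleDensity hA).aestronglyMeasurable 1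
    (ae_of_all _ fun x => by
      rw [Real.norm_of_nonneg (sampleDensity_nonneg A x)]
      exact sampleDensity_le_one A x)

/-- An injective index tuple picks independent points and contributes exactly the measure of `A`;
the other index tuples have weight at most `|ι|² / (n + 1)`. -/
theorem abs_integral_sampleDensity_sub_le {A : Set (ι → X)} (hA : MeasurableSet A) :
    |∫ x, sampleDensity A x ∂(Measure.pi fun _ : Fin (n + 1) => ν) -
      (Measure.pi fun _ : ι => ν).real A| ≤ (Fintype.card ι : ℝ) ^ 2 * (1 / (n + 1)) := by
  classical
  set U := Measure.pi fun _ : ι => uniformMeasure (Fin (n + 1)) with hU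
  have hind : ∀ i : ι → Fin (n + 1), Measurable fun x : Fin (n + 1) → X =>
      A.indicator (1 : (ι → X) → ℝ) (fun k => x (i k)) := fun i =>
    (measurable_const.indicator hA).comp (by fun_prop)
  have hterm : ∀ i : ι → Fin (n + 1), ∫ x, A.indicator (1 : (ι → X) → ℝ) (fun k => x (i k))
      ∂(Measure.pi fun _ : Fin (n + 1) => ν) =
      (Measure.pi fun _ : Fin (n + 1) => ν).real {x | (fun k => x (i k)) ∈ A} := by
    intro i
    rw [← integral_indicator_one]
    · rfl
    · exact hA.preimage (f := fun x : Fin (n + 1) → X => fun k => x (i k)) (by fun_prop)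
  have h1 : ∫ x, sampleDensity A x ∂(Measure.pi fun _ : Fin (n + 1) => ν) =
      ∑ i, U.real {i} * (Measure.pi fun _ : Fin (n + 1) => ν).real {x | (fun k => x (i k)) ∈ A} := by
    rw [funext (sampleDensity_eq_sum (n := n) A)]
    rw [integral_finsetSum]
    · refine Finset.sum_congr rfl fun i _ => ?_
      rw [integral_const_mul, hterm]
    · intro i _
      refine Integrable.const_mul (Integrable.of_bound (hind i).aestronglyMeasurable 1
        (ae_of_all _ fun x => ?_)) _
      by_cases h : (fun k => x (i k)) ∈ A <;> simp [h]
  have hsum : ∑ i, U.real {i} = 1 := by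
    rw [sum_measureReal_singleton]
    simp
  have h2 : (Measure.pi fun _ : ι => ν).real A =
      ∑ i, U.real {i} * (Measure.pi fun _ : ι => ν).real A := by
    rw [← Finset.sum_mul, hsum, one_mul]
  have hnon : U.real {i | ¬ i.Injective} = ∑ i, U.real {i} * if i.Injective then 0 else 1 := by
    have hS := Set.toFinite {i : ι → Fin (n + 1) | ¬ i.Injective}
    simp only [mul_ite, mul_zero, mul_one]
    rw [← hS.coe_toFinset, ← sum_measureReal_singleton]
    rw [Finset.sum_ite]
    simp
  have hle := measureReal_not_injective_le (ι := ι) (uniformMeasure (Fin (n + 1)))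
    (Set.toFinite _).measurableSet
  rw [uniformMeasure_prod_diagonal, Nat.card_eq_fintype_card, Fintype.card_fin, Nat.cast_add,
    Nat.cast_one] at hle
  refine le_trans ?_ hle
  rw [h1, h2, ← Finset.sum_sub_distrib, ← hU, hnon]
  refine (Finset.abs_sum_le_sum_abs _ _).trans (Finset.sum_le_sum fun i _ => ?_)
  rw [← mul_sub, abs_mul, abs_of_nonneg measureReal_nonneg]
  refine mul_le_mul_of_nonneg_left ?_ measureReal_nonneg
  split_ifs with hi
  · have : (Measure.pi fun _ : Fin (n + 1) => ν).real {x | (fun k => x (i k)) ∈ A} =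
        (Measure.pi fun _ : ι => ν).real A := by
      rw [← Measure.pi_map_comp_injective ν hi, map_measureReal_apply (by fun_prop) hA]
      rfl
    rw [this, sub_self, abs_zero]
  · rw [abs_le]
    have a1 : (Measure.pi fun _ : Fin (n + 1) => ν).real {x | (fun k => x (i k)) ∈ A} ≤ 1 :=
      measureReal_le_one
    have a2 : (Measure.pi fun _ : ι => ν).real A ≤ 1 := measureReal_le_one
    have a3 : 0 ≤ (Measure.pi fun _ : Fin (n + 1) => ν).real {x | (fun k => x (i k)) ∈ A} :=
      measureReal_nonneg
    have a4 : 0 ≤ (Measure.pi fun _ : ι => ν).real A := measureReal_nonneg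
    constructor <;> linarith

/-- The tuples indexed by `ι ⊕ ι` both of whose halves lie in `A`. -/
def doubleSet {Y : Type*} (A : Set (ι → Y)) : Set (ι ⊕ ι → Y) :=
  {x | (fun k => x (Sum.inl k)) ∈ A ∧ (fun k => x (Sum.inr k)) ∈ A}

omit [Fintype ι] in
theorem measurableSet_doubleSet {A : Set (ι → X)} (hA : MeasurableSet A) :
    MeasurableSet (doubleSet A) :=
  (hA.preimage (f := fun x : ι ⊕ ι → X => fun k => x (Sum.inl k)) (by fun_prop)).inter
    (hA.preimage (f := fun x : ι ⊕ ι → X => fun k => x (Sum.inr k)) (by fun_prop))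

theorem measureReal_doubleSet {A : Set (ι → X)} (hA : MeasurableSet A) :
    (Measure.pi fun _ : ι ⊕ ι => ν).real (doubleSet A) =
      (Measure.pi fun _ : ι => ν).real A ^ 2 := by
  have h := measurePreserving_sumPiEquivProdPi (fun _ : ι ⊕ ι => ν)
  rw [sq, ← measureReal_prod_prod, ← h.map_eq, map_measureReal_apply h.measurable (hA.prod hA)]
  rfl

omit [MeasurableSpace X] in
theorem sampleDensity_doubleSet (A : Set (ι → X)) (x : Fin (n + 1) → X) :
    sampleDensity (doubleSet A) x = sampleDensity A x ^ 2 :=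
  measureReal_doubleSet (uniformMeasure (Fin (n + 1)))
    (A := {i : ι → Fin (n + 1) | (fun k => x (i k)) ∈ A}) (Set.toFinite _).measurableSet

theorem integrable_sq_sampleDensity_sub {A : Set (ι → X)} (hA : MeasurableSet A) (c : ℝ) :
    Integrable (fun x => (sampleDensity A x - c) ^ 2) (Measure.pi fun _ : Fin (n + 1) => ν) := by
  have : (fun x : Fin (n + 1) → X => (sampleDensity A x - c) ^ 2) =
      fun x => sampleDensity (doubleSet A) x - 2 * c * sampleDensity A x + c ^ 2 := by
    funext x
    rw [sampleDensity_doubleSet]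
    ring
  rw [this]
  exact ((integrable_sampleDensity ν (measurableSet_doubleSet hA)).sub
    ((integrable_sampleDensity ν hA).const_mul _)).add (integrable_const _)

/-- The squared density is itself the sample density of `doubleSet A`, so the second moment reduces
to the bound on means, applied to `A` and to `doubleSet A`. -/
theorem integral_sq_sampleDensity_sub_le {A : Set (ι → X)} (hA : MeasurableSet A) :
    ∫ x, (sampleDensity A x - (Measure.pi fun _ : ι => ν).real A) ^ 2
      ∂(Measure.pi fun _ : Fin (n + 1) => ν) ≤ 6 * (Fintype.card ι : ℝ) ^ 2 * (1 / (n + 1)) := by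
  set q := (Measure.pi fun _ : ι => ν).real A with hq
  have : (fun x : Fin (n + 1) → X => (sampleDensity A x - q) ^ 2) =
      fun x => sampleDensity (doubleSet A) x - 2 * q * sampleDensity A x + q ^ 2 := by
    funext x
    rw [sampleDensity_doubleSet]
    ring
  have i1 := integrable_sampleDensity (n := n) ν (measurableSet_doubleSet hA)
  have i2 := (integrable_sampleDensity (n := n) ν hA).const_mul (2 * q)
  rw [this, integral_add (f := fun x => sampleDensity (doubleSet A) x - 2 * q * sampleDensity A x)
    (i1.sub i2) (integrable_const _), integral_sub i1 i2, integral_const_mul]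
  simp only [integral_const, probReal_univ, smul_eq_mul, one_mul]
  have b1 := abs_le.1 (abs_integral_sampleDensity_sub_le (n := n) ν (measurableSet_doubleSet hA))
  have b2 := abs_le.1 (abs_integral_sampleDensity_sub_le (n := n) ν hA)
  rw [measureReal_doubleSet ν hA, ← hq, Fintype.card_sum, Nat.cast_add] at b1
  rw [← hq] at b2
  have hq0 : 0 ≤ q := measureReal_nonneg
  have hq1 : q ≤ 1 := measureReal_le_one
  set c := (Fintype.card ι : ℝ) ^ 2 * (1 / ((n : ℝ) + 1)) with hc
  have hc0 : 0 ≤ c := by positivity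
  -- Doubling the index set multiplies the error by `4`; the total is at most `4 * c + 2 * q * c ≤ 6
  -- * c`.
  have e1 : ((Fintype.card ι : ℝ) + Fintype.card ι) ^ 2 * (1 / ((n : ℝ) + 1)) = 4 * c := by
    rw [hc]; ring
  rw [e1] at b1
  have e2 : 6 * (Fintype.card ι : ℝ) ^ 2 * (1 / ((n : ℝ) + 1)) = 6 * c := by
    rw [hc]; ring
  rw [e2]
  nlinarith [b1.1, b1.2, b2.1, b2.2, mul_le_mul_of_nonneg_left b2.1 hq0, mul_nonneg hq0 hc0,
    mul_le_mul_of_nonneg_right hq1 hc0]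

end Sampling

/-! ### Samples converging to a Borel graph -/

theorem homDensity_comap_eq_sampleDensity {V : Type u} [MeasurableSpace V] (G : SimpleGraph V)
    {p n : ℕ} (F : SimpleGraph (Fin p)) (x : Fin (n + 1) → V) :
    homDensity F (G.comap x) = sampleDensity (homSet F G) x := by
  rw [homDensity_eq_measureReal]
  rfl

/-- Every Borel graph is the left limit of a sequence of its finite samples. -/
theorem BorelGraph.exists_isLeftLimit_sample (H : BorelGraph.{u}) :
    ∃ (n : ℕ → ℕ) (x : ∀ k, Fin (n k + 1) → H.V), (∀ k, k ≤ n k) ∧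
      H.IsLeftLimit fun k => H.graph.comap (x k) := by
  -- There are countably many graphs `F`; the `k`-th sample need only be accurate for the first `k`
  -- of them.
  obtain ⟨e, he⟩ := exists_surjective_nat (Σ p : ℕ, SimpleGraph (Fin p))
  have hstep : ∀ k : ℕ, ∃ (n : ℕ) (x : Fin (n + 1) → H.V), k ≤ n ∧
      ∑ i ∈ Finset.range k, (_root_.homDensity (e i).2 (H.graph.comap x) -
        H.homDensity (e i).2) ^ 2 ≤ 1 / (k + 1 : ℝ) := by
    intro k
    have hlim : Tendsto (fun n : ℕ => ∑ i ∈ Finset.range k,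
        6 * ((e i).1 : ℝ) ^ 2 * (1 / ((n : ℝ) + 1))) atTop (𝓝 0) := by
      have := tendsto_finsetSum (Finset.range k) fun i _ =>
        (tendsto_one_div_add_atTop_nhds_zero_nat (𝕜 := ℝ)).const_mul (6 * ((e i).1 : ℝ) ^ 2)
      simpa using this
    obtain ⟨n, hn1, hn2⟩ := ((hlim.eventually (gt_mem_nhds
      (show (0 : ℝ) < 1 / (k + 1 : ℝ) by positivity))).and (eventually_ge_atTop k)).exists
    have hm : ∀ i, MeasurableSet (homSet (e i).2 H.graph) := fun i =>
      measurableSet_homSet H.measurableSet_adj _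
    have hint : Integrable (fun x : Fin (n + 1) → H.V => ∑ i ∈ Finset.range k,
        (sampleDensity (homSet (e i).2 H.graph) x - H.homDensity (e i).2) ^ 2)
        (Measure.pi fun _ => H.ν) :=
      integrable_finsetSum _ fun i _ => integrable_sq_sampleDensity_sub H.ν (hm i) _
    -- Some sample does no worse than the mean of the total squared error, so no almost sure
    -- statement is needed.
    obtain ⟨x, hx⟩ := exists_le_integral hint
    refine ⟨n, x, hn2, ?_⟩
    simp only [homDensity_comap_eq_sampleDensity]
    refine hx.trans (le_trans ?_ hn1.le)
    rw [integral_finsetSum _ fun i _ => integrable_sq_sampleDensity_sub H.ν (hm i) _]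
    refine Finset.sum_le_sum fun i _ => ?_
    have := integral_sq_sampleDensity_sub_le (n := n) H.ν (hm i)
    rwa [Fintype.card_fin] at this
  choose n x hn hx using hstep
  refine ⟨n, x, hn, fun p F => ?_⟩
  obtain ⟨i, hi⟩ := he ⟨p, F⟩
  have hsq : Tendsto (fun k => (_root_.homDensity F (H.graph.comap (x k)) - H.homDensity F) ^ 2)
      atTop (𝓝 0) := by
    refine squeeze_zero' (Eventually.of_forall fun k => sq_nonneg _) ?_
      (tendsto_one_div_add_atTop_nhds_zero_nat (𝕜 := ℝ))
    filter_upwards [eventually_gt_atTop i] with k hk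
    refine le_trans ?_ (hx k)
    have := Finset.single_le_sum (f := fun i => (_root_.homDensity (e i).2 (H.graph.comap (x k)) -
      H.homDensity (e i).2) ^ 2) (fun _ _ => sq_nonneg _) (Finset.mem_range.2 hk)
    rw [hi] at this
    exact this
  have habs := hsq.sqrt
  simp only [Real.sqrt_sq_eq_abs, Real.sqrt_zero] at habs
  exact tendsto_sub_nhds_zero_iff.1 ((tendsto_zero_iff_abs_tendsto_zero _).2 habs)

/-- Finite samples of the interpretation of a colored tree-semilattice. -/
theorem exists_seq_isMPartiteCograph {m : ℕ} (hm : 1 ≤ m)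
    (A : ColoredBorelTreeSemilattice.{v} (Palette m)) (μ : Measure A.T) [IsProbabilityMeasure μ]
    (h0 : ∀ x, (A.interp μ).ν {x} = 0) :
    ∃ (V : ℕ → Type) (G : ∀ n, SimpleGraph (V n)),
      (∀ n, IsMPartiteCograph m (G n)) ∧
      Tendsto (fun n => Nat.card (V n)) atTop atTop ∧
      (A.interp μ).IsLeftLimit G ∧ (A.interp μ).IsQFLimit G := by
  obtain ⟨n, x, hn, hx⟩ := (A.interp μ).exists_isLeftLimit_sample
  have hcard : Tendsto (fun k => Nat.card (Fin (n k + 1))) atTop atTop := by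
    refine tendsto_atTop_mono (fun k => ?_) tendsto_id
    rw [Nat.card_eq_fintype_card, Fintype.card_fin]
    exact (hn k).trans (Nat.le_succ _)
  refine ⟨fun k => Fin (n k + 1), fun k => (A.interp μ).graph.comap (x k), fun k => ?_, hcard, hx,
    hx.isQFLimit (fun _ => inferInstance) (fun _ => inferInstance) h0 hcard⟩
  exact isMPartiteCograph_sample hm A (fun i => (x k i).1) _ fun a b => Iff.rfl

theorem ColoredBorelTreeSemilattice.interp_singleton {m : ℕ}
    (A : ColoredBorelTreeSemilattice.{v} (Palette m)) (μ : Measure A.T) [IsProbabilityMeasure μ]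
    (h0 : ∀ x, μ {x} = 0) (x : (A.interp μ).V) : (A.interp μ).ν {x} = 0 := by
  have h : ∀ y : μ.support, (μ.comap ((↑) : μ.support → A.T)) {y} = 0 := by
    intro y
    rw [comap_subtype_coe_apply Measure.isClosed_support.measurableSet, Set.image_singleton]
    exact h0 _
  exact h x

/-! ### Levels of a finite rooted tree -/

namespace RootedTree

section Level

variable {T : RootedTree.{v}} {V : Type u}

/-- The number of leaves above a node. -/
noncomputable def weight (leaf : V ≃ {t : T // IsMax t}) (t : T) : ℕ :=
  {x : V | t ≤ leaf x}.ncard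

/-- The nodes below the leaf of `x` with at most a fraction `2⁻ʲ` of all leaves above them. -/
def lightNodes (leaf : V ≃ {t : T // IsMax t}) (j : ℕ) (x : V) : Set T :=
  {t | t ≤ leaf x ∧ weight leaf t * 2 ^ j ≤ Nat.card V}

open Classical in
/-- The least node below the leaf of `x` with at most a fraction `2⁻ʲ` of all leaves above it. -/
noncomputable def level (leaf : V ≃ {t : T // IsMax t}) (j : ℕ) (x : V) : T :=
  if h : ∃ t, IsLeast (lightNodes leaf j x) t then h.choose else ⊥

variable [Finite T] (leaf : V ≃ {t : T // IsMax t})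

omit [Finite T] in
theorem weight_leaf (x : V) : weight leaf (leaf x) = 1 := by
  rw [weight, Set.ncard_eq_one]
  refine ⟨x, ?_⟩
  ext y
  simp only [Set.mem_ofPred_eq, Set.mem_singleton_iff]
  constructor
  · intro h
    exact leaf.injective (Subtype.ext (le_antisymm ((leaf x).2 h) h))
  · rintro rfl
    exact le_rfl

/-- The bound on `j` makes the leaf itself light, so the set is nonempty; it is a chain, so a
minimal element is least. -/
theorem isLeast_level {j : ℕ} (hj : 2 ^ j ≤ Nat.card V) (x : V) :
    IsLeast (lightNodes leaf j x) (level leaf j x) := by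
  have h : ∃ t, IsLeast (lightNodes leaf j x) t := by
    have hx : (leaf x : T) ∈ lightNodes leaf j x :=
      ⟨le_rfl, by rw [weight_leaf, one_mul]; exact hj⟩
    obtain ⟨t, ht⟩ := (Set.toFinite (lightNodes leaf j x)).exists_minimal ⟨_, hx⟩
    refine ⟨t, ht.1, fun s hs => ?_⟩
    rcases le_total_of_directed hs.1 ht.1.1 with h | h
    · exact h
    · exact ht.2 hs h
  rw [level, dif_pos h]
  exact h.choose_spec

theorem ncard_level_eq_le [Finite V] {j : ℕ} (hj : 2 ^ j ≤ Nat.card V) (y : V) :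
    {x | level leaf j x = level leaf j y}.ncard * 2 ^ j ≤ Nat.card V := by
  refine le_trans (Nat.mul_le_mul_right _ (Set.ncard_le_ncard ?_ (Set.toFinite _)))
    (isLeast_level leaf hj y).1.2
  intro x hx
  have : level leaf j y = level leaf j x := Eq.symm hx
  exact this ▸ (isLeast_level leaf hj x).1.1

theorem level_zero [Finite V] (x y : V) : level leaf 0 x = level leaf 0 y := by
  have hpos : 2 ^ 0 ≤ Nat.card V := by
    have : Nonempty V := ⟨x⟩
    exact Nat.card_pos
  have h : ∀ z, level leaf 0 z = ⊥ := fun z =>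
    le_bot_iff.1 ((isLeast_level leaf hpos z).2 ⟨bot_le, by
      rw [pow_zero, mul_one, weight, ← Set.ncard_univ]
      exact Set.ncard_le_ncard (Set.subset_univ _)⟩)
  rw [h, h]

variable {leaf}

/-- If the node of `x` were below the leaf of `y`, it would be light for `y`, so the node of `y`
would lie below it and thus be light for `x`; by leastness the two would coincide. -/
theorem level_not_le {j : ℕ} (hj : 2 ^ j ≤ Nat.card V) {x y : V}
    (hne : level leaf j x ≠ level leaf j y) : ¬ level leaf j x ≤ leaf y := by
  intro h
  have hx := isLeast_level leaf hj x
  have hy := isLeast_level leaf hj y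
  have h1 : level leaf j y ≤ level leaf j x := hy.2 ⟨h, hx.1.2⟩
  exact hne (le_antisymm (hx.2 ⟨h1.trans hx.1.1, hy.1.2⟩) h1)

theorem le_pred_level {t : T} {j : ℕ} {x : V} (hj : 2 ^ j ≤ Nat.card V) (htx : t ≤ leaf x)
    (h : ¬ level leaf j x ≤ t) : t ≤ Order.pred (level leaf j x) := by
  rcases le_total_of_directed htx (isLeast_level leaf hj x).1.1 with h' | h'
  · exact absurd h' h
  · exact Order.le_pred_of_lt (lt_of_le_not_ge h' h)

theorem pred_level_lt {j : ℕ} (hj : 2 ^ j ≤ Nat.card V) {x y : V}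
    (hne : level leaf j x ≠ level leaf j y) :
    Order.pred (level leaf j x) < level leaf j x := by
  refine Order.pred_lt_of_not_isMin fun h => level_not_le hj hne ?_
  rw [isMin_iff_eq_bot.1 h]
  exact bot_le

theorem card_lt_weight_pred_level {j : ℕ} (hj : 2 ^ j ≤ Nat.card V) {x y : V}
    (hne : level leaf j x ≠ level leaf j y) :
    Nat.card V < weight leaf (Order.pred (level leaf j x)) * 2 ^ j := by
  have hlt := pred_level_lt hj hne
  have hx := isLeast_level leaf hj x
  by_contra h
  exact (hx.2 ⟨hlt.le.trans hx.1.1, not_lt.1 h⟩).not_gt hlt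

/-- If the levels `j` of `x` and `y` are distinct and their previous levels are equal, then their
parents are comparable. -/
theorem pred_level_le_total [Finite V] {j : ℕ} (hj : 2 ^ (j + 1) ≤ Nat.card V) {x y : V}
    (heq : level leaf j x = level leaf j y)
    (hne : level leaf (j + 1) x ≠ level leaf (j + 1) y) :
    Order.pred (level leaf (j + 1) x) ≤ Order.pred (level leaf (j + 1) y) ∨
      Order.pred (level leaf (j + 1) y) ≤ Order.pred (level leaf (j + 1) x) := by
  have hj' : 2 ^ j ≤ Nat.card V := (Nat.pow_le_pow_right two_pos (Nat.le_succ j)).trans hj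
  have hux := (isLeast_level leaf hj' x).1
  have huy := (isLeast_level leaf hj' y).1
  rw [← heq] at huy
  set p := Order.pred (level leaf (j + 1) x)
  set q := Order.pred (level leaf (j + 1) y)
  -- The common node at level `j` is below both leaves, so no node at level `j + 1` can be below it;
  -- it is therefore below both parents.
  have hp : level leaf j x ≤ p := le_pred_level hj hux.1 fun h =>
    level_not_le hj hne (h.trans huy.1)
  have hq : level leaf j x ≤ q := le_pred_level hj huy.1 fun h =>
    level_not_le hj hne.symm (h.trans hux.1)
  have hwp : Nat.card V < weight leaf p * 2 ^ (j + 1) := card_lt_weight_pred_level hj hne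
  have hwq : Nat.card V < weight leaf q * 2 ^ (j + 1) := card_lt_weight_pred_level hj hne.symm
  by_contra hcon
  -- Incomparable parents have disjoint leaf sets. Each exceeds `|V| / 2 ^ (j + 1)` and both lie
  -- above a node with at most `|V| / 2 ^ j` leaves, a contradiction.
  have hdisj : Disjoint {z : V | p ≤ leaf z} {z : V | q ≤ leaf z} :=
    Set.disjoint_left.2 fun z hz hz' => hcon (le_total_of_directed hz' hz)
  have hle : weight leaf p + weight leaf q ≤ weight leaf (level leaf j x) := by
    rw [weight, weight, ← Set.ncard_union_eq hdisj (Set.toFinite _) (Set.toFinite _)]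
    refine Set.ncard_le_ncard ?_ (Set.toFinite _)
    rintro z (hz | hz)
    · exact hp.trans hz
    · exact hq.trans hz
  have h2 := hux.2
  have h3 := Nat.mul_le_mul_right (2 ^ j) hle
  rw [pow_succ] at hwp hwq
  nlinarith

/-- The smaller parent is below both leaves, while the node just above it on the branch of `x` is
not below the leaf of `y`. -/
theorem inf_eq_pred_level {j : ℕ} (hj : 2 ^ j ≤ Nat.card V) {x y : V}
    (hne : level leaf j x ≠ level leaf j y)
    (hle : Order.pred (level leaf j x) ≤ Order.pred (level leaf j y)) :
    (leaf x : T) ⊓ leaf y = Order.pred (level leaf j x) := by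
  refine le_antisymm (le_pred_level hj inf_le_left fun h => ?_) (le_inf ?_ ?_)
  · exact level_not_le hj hne (h.trans inf_le_right)
  · exact (Order.pred_le _).trans (isLeast_level leaf hj x).1.1
  · exact (hle.trans (Order.pred_le _)).trans (isLeast_level leaf hj y).1.1

end Level

end RootedTree

/-- The vertices of blow-ups of an `m`-partite cograph can be coded by sequences of keys and colors
such that adjacency of two vertices is determined by the color going with the smaller key at the
first place where their codes differ, while the classes of vertices with equal `j`-th keys have
relative size at most `2⁻ʲ`. -/
theorem IsMPartiteCograph.exists_keys {m : ℕ} {V : Type u} [Finite V] {G : SimpleGraph V}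
    (hG : IsMPartiteCograph m G) (n : ℕ) :
    ∃ (key : ℕ → V × Fin n → ℕ ×ₗ ℕ) (c : ℕ → V × Fin n → SymFun m) (label : V → Fin m),
      (∀ j x y, key j x = key j y → c j x = c j y) ∧
      (∀ j x y, (∀ i < j, key i x = key i y) → key j x < key j y →
        (G.Adj x.1 y.1 ↔ (c j x).1 (label x.1) (label y.1) = true)) ∧
      ∀ j y, {x | key j x = key j y}.ncard * 2 ^ j ≤ Nat.card (V × Fin n) ∨
        {x | key j x = key j y}.ncard ≤ 1 := by
  classical
  obtain ⟨T, hT, leaf, label, f, hadj⟩ := hG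
  obtain ⟨enum, henum⟩ := exists_injective_nat T
  obtain ⟨enum', henum'⟩ := exists_injective_nat (V × Fin n)
  let height : T → ℕ := fun t => (Set.Iio t).ncard
  have hheight : ∀ {s t : T}, s < t → height s < height t := fun {s t} h =>
    Set.ncard_lt_ncard (Set.Iio_ssubset_Iio h) (Set.toFinite _)
  -- Height comes first so that the smaller key belongs to the parent nearer the root; the
  -- enumeration separates distinct nodes. Once `2 ^ j` exceeds `|V|` the keys separate all points
  -- of the blow-up.
  let key : ℕ → V × Fin n → ℕ ×ₗ ℕ := fun j x =>
    if 2 ^ j ≤ Nat.card V then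
      toLex (height (Order.pred (RootedTree.level leaf j x.1)), enum (RootedTree.level leaf j x.1))
    else toLex (enum' x, 0)
  -- The default is harmless: keys that first differ in that range belong to copies of one vertex,
  -- which are not adjacent.
  let c : ℕ → V × Fin n → SymFun m := fun j x =>
    if 2 ^ j ≤ Nat.card V then f (Order.pred (RootedTree.level leaf j x.1))
    else ⟨fun _ _ => false, fun _ _ => rfl⟩
  have hkey : ∀ {j x y}, 2 ^ j ≤ Nat.card V → key j x = key j y →
      RootedTree.level leaf j x.1 = RootedTree.level leaf j y.1 := by
    intro j x y hj h
    simp only [key, hj, if_true] at h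
    exact henum (congrArg (fun z => (ofLex z).2) h)
  have hkey' : ∀ {j x y}, ¬ 2 ^ j ≤ Nat.card V → key j x = key j y → x = y := by
    intro j x y hj h
    simp only [key, hj, if_false] at h
    exact henum' (congrArg (fun z => (ofLex z).1) h)
  have hc : ∀ {j x}, 2 ^ j ≤ Nat.card V →
      c j x = f (Order.pred (RootedTree.level leaf j x.1)) := fun hj => if_pos hj
  have hc' : ∀ {j x}, ¬ 2 ^ j ≤ Nat.card V → c j x = ⟨fun _ _ => false, fun _ _ => rfl⟩ :=
    fun hj => if_neg hj
  refine ⟨key, c, label, ?_, ?_, ?_⟩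
  · intro j x y h
    by_cases hj : 2 ^ j ≤ Nat.card V
    · rw [hc hj, hc hj, hkey hj h]
    · rw [hc' hj, hc' hj]
  · intro j x y heq hlt
    by_cases hj : 2 ^ j ≤ Nat.card V
    · have hne : RootedTree.level leaf j x.1 ≠ RootedTree.level leaf j y.1 := by
        intro h
        simp only [key, hj, if_true, h, lt_self_iff_false] at hlt
      cases j with
      | zero => exact absurd (RootedTree.level_zero leaf x.1 y.1) hne
      | succ j =>
        have hj' : 2 ^ j ≤ Nat.card V := (Nat.pow_le_pow_right two_pos (Nat.le_succ j)).trans hj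
        have hle : Order.pred (RootedTree.level leaf (j + 1) x.1) ≤
            Order.pred (RootedTree.level leaf (j + 1) y.1) := by
          rcases RootedTree.pred_level_le_total hj (hkey hj' (heq j (Nat.lt_succ_self j))) hne
            with h | h
          · exact h
          · rcases h.eq_or_lt with h' | h'
            · exact h'.ge
            -- If the parent for `y` were strictly nearer the root, `y` would have the smaller key.
            · have := hheight h'
              simp only [key, hj, if_true, Prod.Lex.toLex_lt_toLex] at hlt
              omega
        have hxy : x.1 ≠ y.1 := fun h => hne (by rw [h])
        rw [hadj _ _ hxy, RootedTree.inf_eq_pred_level hj hne hle]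
        rw [hc hj]
    · have hxy : x.1 = y.1 := by
        have : Nonempty V := ⟨x.1⟩
        -- At this last admissible level a class has size at most `|V| / 2 ^ k < 2`, so equal keys
        -- there force equal vertices of `V`.
        set k := Nat.log 2 (Nat.card V)
        have hk : 2 ^ k ≤ Nat.card V := Nat.pow_log_le_self 2 Nat.card_pos.ne'
        have hkj : k < j := by
          by_contra h
          exact hj ((Nat.pow_le_pow_right two_pos (not_lt.1 h)).trans hk)
        have h1 := hkey hk (heq k hkj)
        have h2 := RootedTree.ncard_level_eq_le leaf hk y.1
        have h3 : Nat.card V < 2 ^ (k + 1) := Nat.lt_pow_succ_log_self one_lt_two _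
        have h4 : {z | RootedTree.level leaf k z = RootedTree.level leaf k y.1}.ncard ≤ 1 := by
          rw [pow_succ] at h3
          by_contra h
          have := Nat.mul_le_mul_right (2 ^ k) (not_le.1 h)
          simp only [Nat.succ_eq_add_one] at this
          omega
        exact (Set.ncard_le_one (Set.toFinite _)).1 h4 _ h1 _ rfl
      simp [hc' hj, hxy]
  · intro j y
    by_cases hj : 2 ^ j ≤ Nat.card V
    · left
      have h1 := RootedTree.ncard_level_eq_le leaf hj y.1
      have h2 : {x | key j x = key j y}.ncard ≤
          {z | RootedTree.level leaf j z = RootedTree.level leaf j y.1}.ncard * n := by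
        have h3 : {x | key j x = key j y} ⊆
            {z | RootedTree.level leaf j z = RootedTree.level leaf j y.1} ×ˢ Set.univ :=
          fun x hx => ⟨hkey hj hx, trivial⟩
        refine (Set.ncard_le_ncard h3 (Set.toFinite _)).trans ?_
        rw [Set.ncard_prod, Set.ncard_univ, Nat.card_eq_fintype_card, Fintype.card_fin]
      rw [Nat.card_prod, Nat.card_eq_fintype_card (α := Fin n), Fintype.card_fin]
      calc _ ≤ _ := Nat.mul_le_mul_right _ h2
        _ = _ := mul_right_comm _ _ _
        _ ≤ _ := Nat.mul_le_mul_right _ h1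
    · right
      rw [Set.ncard_le_one (Set.toFinite _)]
      intro a ha b hb
      exact hkey' hj (Eq.trans ha (Eq.symm hb))

/-! ### The tree-semilattice of sequences -/

/-- Sequences over a linear order with a least element, ordered as a tree: the meet of two distinct
sequences consists of their common initial segment and the smaller of the first distinct letters,
followed by least letters. -/
def SeqTree (L : Type u) : Type u := ℕ → L

namespace SeqTree

variable {L : Type u} [LinearOrder L] [OrderBot L]

theorem exists_first_ne {X : Type*} {x y : ℕ → X} (h : x ≠ y) :
    ∃ k, (∀ i < k, x i = y i) ∧ x k ≠ y k := by
  classical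
  have h' : ∃ k, x k ≠ y k := Function.ne_iff.1 h
  exact ⟨Nat.find h', fun i hi => not_not.1 (Nat.find_min h' hi), Nat.find_spec h'⟩

open Classical in
/-- The meet of two sequences. -/
noncomputable def meet (x y : ℕ → L) (n : ℕ) : L :=
  if ∀ i < n, x i = y i then x n ⊓ y n else ⊥

theorem meet_apply_of_eq {x y : ℕ → L} {n : ℕ} (h : ∀ i < n, x i = y i) :
    meet x y n = x n ⊓ y n :=
  if_pos h

theorem meet_apply_of_ne {x y : ℕ → L} {k n : ℕ} (hk : k < n) (h : x k ≠ y k) :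
    meet x y n = ⊥ :=
  if_neg fun h' => h (h' k hk)

theorem meet_comm (x y : ℕ → L) : meet x y = meet y x := by
  funext n
  simp only [meet, inf_comm (x n), @eq_comm _ (x _)]

theorem meet_self (x : ℕ → L) : meet x x = x := by
  funext n
  simp [meet]

theorem meet_apply_le_right (x y : ℕ → L) (n : ℕ) : meet x y n ≤ y n := by
  unfold meet
  split_ifs
  · exact inf_le_right
  · exact bot_le

-- This form is symmetric in the three sequences, up to rewriting the equalities, and so yields
-- associativity.
open Classical in
theorem meet_meet_apply (x y z : ℕ → L) (n : ℕ) :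
    meet (meet x y) z n =
      if ∀ i < n, x i = y i ∧ x i = z i then x n ⊓ y n ⊓ z n else ⊥ := by
  by_cases h : ∀ i < n, x i = y i
  · have hxy : ∀ i < n, meet x y i = x i := by
      intro i hi
      rw [meet_apply_of_eq fun k hk => h k (hk.trans hi), ← h i hi, inf_idem]
    by_cases h' : ∀ i < n, x i = z i
    · rw [if_pos fun i hi => ⟨h i hi, h' i hi⟩,
        meet_apply_of_eq fun i hi => (hxy i hi).trans (h' i hi), meet_apply_of_eq h]
    · rw [if_neg fun h'' => h' fun i hi => (h'' i hi).2]
      refine if_neg fun h'' => h' fun i hi => ?_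
      rw [← h'' i hi, hxy i hi]
  · rw [if_neg fun h'' => h fun i hi => (h'' i hi).1]
    have h0 : meet x y n = ⊥ := if_neg h
    conv_lhs => rw [meet, h0, bot_inf_eq, ite_self]

theorem meet_assoc (x y z : ℕ → L) : meet (meet x y) z = meet x (meet y z) := by
  funext n
  rw [meet_comm x (meet y z), meet_meet_apply, meet_meet_apply]
  congr 1
  · refine propext (forall₂_congr fun i _ => ?_)
    constructor
    · rintro ⟨h1, h2⟩
      exact ⟨h1.symm.trans h2, h1.symm⟩
    · rintro ⟨h1, h2⟩
      exact ⟨h2.symm, h2.symm.trans h1⟩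
  · rw [inf_comm (y n ⊓ z n), inf_assoc]

/-- From `x k < y k ≤ z k` the sequence `x` leaves `z` by place `k`. Being below `z`, it is `⊥`
afterwards, just as the meet is. -/
theorem meet_eq_left_of_lt {x y z : ℕ → L} (hx : meet x z = x) (hy : meet y z = y) {k : ℕ}
    (hk : ∀ i < k, x i = y i) (hlt : x k < y k) : meet x y = x := by
  funext i
  rcases lt_trichotomy i k with hi | rfl | hi
  · rw [meet_apply_of_eq fun l hl => hk l (hl.trans hi), ← hk i hi, inf_idem]
  · rw [meet_apply_of_eq hk, inf_eq_left.2 hlt.le]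
  · rw [meet_apply_of_ne hi hlt.ne]
    by_contra h
    have h1 : x k = z k := by
      by_contra h'
      exact h ((congrFun hx i).symm.trans (meet_apply_of_ne hi h')).symm
    have h2 : y k ≤ z k := (congrFun hy k).symm.le.trans (meet_apply_le_right y z k)
    exact (h1 ▸ hlt).not_ge h2

theorem meet_eq_or_eq {x y z : ℕ → L} (hx : meet x z = x) (hy : meet y z = y) :
    meet x y = x ∨ meet x y = y := by
  by_cases h : x = y
  · subst h
    exact Or.inl (meet_self x)
  · obtain ⟨k, hk, hne⟩ := exists_first_ne h
    rcases lt_or_gt_of_ne hne with hlt | hlt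
    · exact Or.inl (meet_eq_left_of_lt hx hy hk hlt)
    · rw [meet_comm]
      exact Or.inr (meet_eq_left_of_lt hy hx (fun i hi => (hk i hi).symm) hlt)

noncomputable instance : SemilatticeInf (SeqTree L) :=
  letI : Min (SeqTree L) := ⟨meet⟩
  SemilatticeInf.mk' meet_comm meet_assoc meet_self

end SeqTree

/-- A tree `S` with `m` leaves attached to every element: `(s, 0)` stands for `s`, and
`(s, i)` for `0 < i` are leaves above it. -/
def LeafTree (S : Type u) (m : ℕ) : Type u := S × Fin (m + 1)

namespace LeafTree

variable {S : Type u} [SemilatticeInf S] {m : ℕ}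

open Classical in
/-- The meet of two elements. -/
noncomputable def meet (x y : S × Fin (m + 1)) : S × Fin (m + 1) :=
  if x = y then x else (x.1 ⊓ y.1, 0)

theorem meet_comm (x y : S × Fin (m + 1)) : meet x y = meet y x := by
  by_cases h : x = y
  · rw [h]
  · rw [meet, meet, if_neg h, if_neg (Ne.symm h), inf_comm]

theorem meet_self (x : S × Fin (m + 1)) : meet x x = x := if_pos rfl

theorem meet_fst (x y : S × Fin (m + 1)) : (meet x y).1 = x.1 ⊓ y.1 := by
  unfold meet
  split_ifs with h
  · rw [h, inf_idem]
  · rfl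

theorem meet_snd (x y : S × Fin (m + 1)) : x = y ∨ (meet x y).2 = 0 := by
  by_cases h : x = y
  · exact Or.inl h
  · exact Or.inr (by rw [meet, if_neg h])

theorem meet_snd_of_left {x : S × Fin (m + 1)} (hx : x.2 = 0) (y : S × Fin (m + 1)) :
    (meet x y).2 = 0 := by
  rcases meet_snd x y with h | h
  · rw [← h, meet_self, hx]
  · exact h

/-- Both sides have label `0` unless the three elements coincide; the first coordinates are meets in
`S`. -/
theorem meet_assoc (x y z : S × Fin (m + 1)) : meet (meet x y) z = meet x (meet y z) := by
  by_cases hxy : x = y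
  · subst hxy
    by_cases hxz : x = z
    · subst hxz
      rw [meet_self]
    · have h0 : (meet x z).2 = 0 := (meet_snd x z).resolve_left hxz
      refine Prod.ext ?_ ?_
      · simp only [meet_fst, inf_assoc]
      · rw [meet_self, meet_comm x (meet x z), meet_snd_of_left h0, h0]
  · have h1 : (meet x y).2 = 0 := (meet_snd x y).resolve_left hxy
    refine Prod.ext ?_ ?_
    · simp only [meet_fst, inf_assoc]
    · rw [meet_snd_of_left h1]
      by_cases hyz : y = z
      · subst hyz
        rw [meet_self, h1]
      · rw [meet_comm, meet_snd_of_left ((meet_snd y z).resolve_left hyz)]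

noncomputable instance : SemilatticeInf (LeafTree S m) :=
  letI : Min (LeafTree S m) := ⟨meet⟩
  SemilatticeInf.mk' meet_comm meet_assoc meet_self

/-- Anything strictly below `z` has label `0`, so the comparison takes place in `S`. -/
theorem meet_eq_or_eq (hS : ∀ x y z : S, x ⊓ z = x → y ⊓ z = y → x ⊓ y = x ∨ x ⊓ y = y)
    (x y z : S × Fin (m + 1)) (hx : meet x z = x) (hy : meet y z = y) :
    meet x y = x ∨ meet x y = y := by
  by_cases hxz : x = z
  · subst hxz
    exact Or.inr ((meet_comm _ _).trans hy)
  by_cases hyz : y = z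
  · subst hyz
    exact Or.inl hx
  have hx0 : x.2 = 0 := (congrArg Prod.snd hx).symm.trans ((meet_snd x z).resolve_left hxz)
  have hy0 : y.2 = 0 := (congrArg Prod.snd hy).symm.trans ((meet_snd y z).resolve_left hyz)
  have hx1 : x.1 ⊓ z.1 = x.1 := (meet_fst x z).symm.trans (congrArg Prod.fst hx)
  have hy1 : y.1 ⊓ z.1 = y.1 := (meet_fst y z).symm.trans (congrArg Prod.fst hy)
  rcases hS _ _ _ hx1 hy1 with h | h
  · refine Or.inl (Prod.ext ?_ ?_)
    · rw [meet_fst, h]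
    · rw [meet_snd_of_left hx0, hx0]
  · refine Or.inr (Prod.ext ?_ ?_)
    · rw [meet_fst, h]
    · rw [meet_snd_of_left hx0, hy0]

end LeafTree

/-! ### The Borel tree-semilattice of codes -/

/-- Letters: a position in the unit interval and a color, ordered lexicographically. -/
abbrev Letter (K : ℕ) : Type := unitInterval ×ₗ Fin (K + 1)

/-- The elements of the universal tree-semilattice: a sequence of positions and colors, together
with a label. -/
abbrev CodeSpace (K m : ℕ) : Type := (ℕ → unitInterval × Fin (K + 1)) × Fin (m + 1)

theorem measurable_letter_inf (K : ℕ) :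
    Measurable fun e : (unitInterval × Fin (K + 1)) × (unitInterval × Fin (K + 1)) =>
      ofLex (toLex e.1 ⊓ toLex e.2) := by
  classical
  have h : (fun e : (unitInterval × Fin (K + 1)) × (unitInterval × Fin (K + 1)) =>
      ofLex (toLex e.1 ⊓ toLex e.2)) = fun e =>
      if e.1.1 < e.2.1 ∨ (e.1.1 = e.2.1 ∧ e.1.2 ≤ e.2.2) then e.1 else e.2 := by
    funext e
    split_ifs with he
    · rw [inf_eq_left.2 (Prod.Lex.toLex_le_toLex.2 he)]
      rfl
    · rw [inf_eq_right.2 (le_of_not_ge fun h => he (Prod.Lex.toLex_le_toLex.1 h))]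
      rfl
  rw [h]
  refine Measurable.ite ?_ measurable_fst measurable_snd
  refine (measurableSet_lt (by fun_prop) (by fun_prop)).union
    ((measurableSet_eq_fun (by fun_prop) (by fun_prop)).inter
      (measurableSet_le (by fun_prop) (by fun_prop)))

theorem measurable_seqTree_meet (K : ℕ) :
    Measurable fun e : (ℕ → unitInterval × Fin (K + 1)) × (ℕ → unitInterval × Fin (K + 1)) =>
      (fun n => ofLex (SeqTree.meet (fun i => toLex (e.1 i)) (fun i => toLex (e.2 i)) n)) := by
  classical
  refine measurable_pi_iff.2 fun n => ?_
  have h : (fun e : (ℕ → unitInterval × Fin (K + 1)) × (ℕ → unitInterval × Fin (K + 1)) =>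
      ofLex (SeqTree.meet (fun i => toLex (e.1 i)) (fun i => toLex (e.2 i)) n)) = fun e =>
      if ∀ i < n, e.1 i = e.2 i then ofLex (toLex (e.1 n) ⊓ toLex (e.2 n)) else
        ofLex (⊥ : Letter K) := by
    funext e
    simp only [SeqTree.meet, toLex_inj]
    split_ifs <;> rfl
  rw [h]
  refine Measurable.ite ?_ ((measurable_letter_inf K).comp
    (f := fun e : (ℕ → unitInterval × Fin (K + 1)) × (ℕ → unitInterval × Fin (K + 1)) =>
      (e.1 n, e.2 n)) (by fun_prop)) measurable_const
  simp only [Set.ofPred_forall]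
  exact MeasurableSet.iInter fun i => MeasurableSet.iInter fun _ =>
    measurableSet_eq_fun (by fun_prop) (by fun_prop)

/-- The colored Borel tree-semilattice of codes. The color of a node is the color of its last
letter with a positive position. -/
noncomputable def codeTree {m K : ℕ} (enc : SymFun m → Fin (K + 1)) :
    ColoredBorelTreeSemilattice.{0} (Palette m) where
  T := CodeSpace K m
  semilatticeInf := inferInstanceAs (SemilatticeInf (LeafTree (SeqTree (Letter K)) m))
  tree := LeafTree.meet_eq_or_eq (S := SeqTree (Letter K)) fun _ _ _ => SeqTree.meet_eq_or_eq
  measurable_inf := by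
    classical
    have : (fun e : CodeSpace K m × CodeSpace K m =>
        (LeafTree.meet (S := SeqTree (Letter K)) e.1 e.2 : CodeSpace K m)) = fun e =>
        (if e.1 = e.2 then e.1 else
          ((fun n => ofLex (SeqTree.meet (fun i => toLex (e.1.1 i)) (fun i => toLex (e.2.1 i)) n) :
            ℕ → unitInterval × Fin (K + 1)), 0) : CodeSpace K m) := by
      funext e
      simp only [LeafTree.meet]
      split_ifs <;> rfl
    refine Eq.subst (motive := Measurable) this.symm ?_
    refine Measurable.ite (measurableSet_eq_fun (by fun_prop) (by fun_prop)) measurable_fst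
      (((measurable_seqTree_meet K).comp
        (f := fun e : CodeSpace K m × CodeSpace K m => (e.1.1, e.2.1)) (by fun_prop)).prodMk
          measurable_const)
  -- Label `i.succ` marks a leaf labelled `i`, and label `0` an inner node. A meet continues with
  -- letters at position `0` after the first difference, so if the smaller letter there has positive
  -- position, it is the last such letter.
  rel := Sum.elim (fun i => {x : CodeSpace K m | x.2 = i.succ})
    (fun f => {x : CodeSpace K m | x.2 = 0 ∧ ∃ k, (x.1 k).1 ≠ 0 ∧ (x.1 k).2 = enc f ∧
      ∀ i, k < i → (x.1 i).1 = 0})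
  measurableSet_rel := by
    rintro (i | f)
    · exact measurableSet_eq_fun measurable_snd measurable_const
    · suffices h : MeasurableSet {x : CodeSpace K m | ∃ k, (x.1 k).1 ≠ 0 ∧ (x.1 k).2 = enc f ∧
          ∀ i, k < i → (x.1 i).1 = 0} from
        (measurableSet_eq_fun measurable_snd measurable_const).inter h
      simp only [Set.ofPred_exists]
      refine MeasurableSet.iUnion fun k => ?_
      refine (measurableSet_eq_fun (by fun_prop) measurable_const).compl.inter
        ((measurableSet_eq_fun (by fun_prop) measurable_const).inter ?_)
      change MeasurableSet {x : CodeSpace K m | ∀ i, k < i → (x.1 i).1 = 0}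
      simp only [Set.ofPred_forall]
      exact MeasurableSet.iInter fun i => MeasurableSet.iInter fun _ =>
        measurableSet_eq_fun (by fun_prop) measurable_const

theorem codeTree_hasColor_leaf {m K : ℕ} (enc : SymFun m → Fin (K + 1)) {x : CodeSpace K m}
    {i : Fin m} (hx : x.2 = i.succ) : (codeTree enc).HasColor x (Sum.inl i) := by
  refine Set.ext fun s => ?_
  rcases s with j | f
  · have : x.2 = j.succ ↔ (Sum.inl j : Palette m) = Sum.inl i := by
      rw [hx, Fin.succ_inj, Sum.inl.injEq, eq_comm]
    exact this
  · have : (x.2 = 0 ∧ ∃ k, (x.1 k).1 ≠ 0 ∧ (x.1 k).2 = enc f ∧ ∀ i, k < i → (x.1 i).1 = 0) ↔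
        (Sum.inr f : Palette m) = Sum.inl i := by
      simp [hx]
    exact this

theorem codeTree_hasColor_node {m K : ℕ} {enc : SymFun m → Fin (K + 1)} (henc : enc.Injective)
    {x : CodeSpace K m} (hx : x.2 = 0) {k : ℕ} (hk : (x.1 k).1 ≠ 0)
    (hk' : ∀ i, k < i → (x.1 i).1 = 0) {f : SymFun m} (hf : (x.1 k).2 = enc f) :
    (codeTree enc).HasColor x (Sum.inr f) := by
  refine Set.ext fun s => ?_
  rcases s with j | g
  · have : x.2 = j.succ ↔ (Sum.inl j : Palette m) = Sum.inr f := by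
      simp [hx, (Fin.succ_ne_zero j).symm]
    exact this
  · have : (x.2 = 0 ∧ ∃ k, (x.1 k).1 ≠ 0 ∧ (x.1 k).2 = enc g ∧ ∀ i, k < i → (x.1 i).1 = 0) ↔
        (Sum.inr g : Palette m) = Sum.inr f := by
      rw [Sum.inr.injEq]
      constructor
      · rintro ⟨-, l, hl, hlg, hl'⟩
        have : l = k := by
          rcases lt_trichotomy l k with h | h | h
          · exact absurd (hl' k h) hk
          · exact h
          · exact absurd (hk' l h) hl
        subst this
        exact henc (hlg.symm.trans hf)
      · rintro rfl
        exact ⟨hx, k, hk, hf, hk'⟩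
    exact this

/-- Adjacency of leaves is decided by the color going with the smaller letter at the first place
where their codes differ. -/
theorem codeTree_interpAdj_iff {m K : ℕ} {enc : SymFun m → Fin (K + 1)} (henc : enc.Injective)
    {x y : CodeSpace K m} {i j : Fin m} (hx : x.2 = i.succ) (hy : y.2 = j.succ) {k : ℕ}
    (hk : ∀ l < k, x.1 l = y.1 l) (hlt : (x.1 k).1 < (y.1 k).1) (h0 : (x.1 k).1 ≠ 0)
    {f : SymFun m} (hf : (x.1 k).2 = enc f) :
    (codeTree enc).InterpAdj x y ↔ f.1 i j = true := by
  have hcol : (codeTree enc).HasColor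
      ((show (codeTree enc).T from x) ⊓ (show (codeTree enc).T from y)) (Sum.inr f) := by
    have hinf : (show (codeTree enc).T from x) ⊓ (show (codeTree enc).T from y) =
        ((fun n => ofLex (SeqTree.meet (fun i => toLex (x.1 i)) (fun i => toLex (y.1 i)) n), 0) :
          CodeSpace K m) := by
      have hne : x ≠ y := by
        rintro rfl
        exact hlt.false
      exact if_neg hne
    rw [hinf]
    have hkk : ofLex (SeqTree.meet (fun i => toLex (x.1 i)) (fun i => toLex (y.1 i)) k) =
        x.1 k := by
      rw [SeqTree.meet_apply_of_eq fun l hl => congrArg toLex (hk l hl),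
        inf_eq_left.2 (Prod.Lex.toLex_le_toLex.2 (Or.inl hlt)), ofLex_toLex]
    refine codeTree_hasColor_node henc rfl (k := k) ?_ ?_ ?_
    · exact (congrArg Prod.fst hkk).trans_ne h0
    · intro l hl
      exact congrArg (fun a : Letter K => (ofLex a).1)
        (SeqTree.meet_apply_of_ne hl fun h => hlt.ne (congrArg Prod.fst (toLex_inj.1 h)))
    · exact (congrArg Prod.snd hkk).trans hf
  rw [ColoredBorelTreeSemilattice.interpAdj_iff (codeTree_hasColor_leaf enc hx)
    (codeTree_hasColor_leaf enc hy)]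
  constructor
  · rintro ⟨g, hg, hgt⟩
    cases Sum.inr_injective (hg.unique hcol)
    exact hgt
  · exact fun h => ⟨f, hcol, h⟩

/-! ### Weak limits of random relations -/

section WeakLimit

variable {X κ : Type*} [TopologicalSpace X] [MeasurableSpace X] [OpensMeasurableSpace X]
  [HasOuterApproxClosed X] {L : Filter κ} {μs : κ → ProbabilityMeasure X} {μ : ProbabilityMeasure X}

theorem ProbabilityMeasure.measureReal_open_le_of_tendsto [L.NeBot] (h : Tendsto μs L (𝓝 μ))
    {U : Set X} (hU : IsOpen U) {η : ℝ} (hη : ∀ᶠ i in L, (μs i : Measure X).real U ≤ η) :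
    (μ : Measure X).real U ≤ η := by
  have hη0 : 0 ≤ η := by
    obtain ⟨i, hi⟩ := hη.exists
    exact measureReal_nonneg.trans hi
  refine ENNReal.toReal_le_of_le_ofReal hη0
    ((ProbabilityMeasure.le_liminf_measure_open_of_tendsto h hU).trans ?_)
  refine liminf_le_of_frequently_le' (Eventually.frequently ?_)
  filter_upwards [hη] with i hi
  exact (ENNReal.le_ofReal_iff_toReal_le (measure_ne_top _ _) hη0).2 hi

theorem ProbabilityMeasure.eventually_measureReal_closed_le (h : Tendsto μs L (𝓝 μ))
    {C : Set X} (hC : IsClosed C) {ε : ℝ} (hε : 0 < ε) :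
    ∀ᶠ i in L, (μs i : Measure X).real C ≤ (μ : Measure X).real C + ε := by
  have h1 := ProbabilityMeasure.limsup_measure_closed_le_of_tendsto h hC
  have h2 : (μ : Measure X) C < ENNReal.ofReal ((μ : Measure X).real C + ε) := by
    rw [← ENNReal.ofReal_toReal (measure_ne_top (μ : Measure X) C)]
    exact (ENNReal.ofReal_lt_ofReal_iff (by positivity)).2 (lt_add_of_pos_right _ hε)
  filter_upwards [eventually_lt_of_limsup_lt (h1.trans_lt h2)] with i hi
  exact ENNReal.toReal_le_of_le_ofReal (by positivity) hi.le

end WeakLimit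

/-! ### Densities of relations that are clopen up to small measure -/

section RelationLimit

variable {X κ : Type*} [TopologicalSpace X] [MeasurableSpace X] [BorelSpace X]
  [SecondCountableTopology X] [TopologicalSpace.PseudoMetrizableSpace X]
  {L : Filter κ} [L.NeBot] {μs : κ → ProbabilityMeasure X} {μ : ProbabilityMeasure X}
  {R : Set (X × X)}

/-- The tuples that are mapped to pairs in `R` by the edges of `F`. -/
def relHomSet {X : Type*} (R : Set (X × X)) {p : ℕ} (F : SimpleGraph (Fin p)) : Set (Fin p → X) :=
  {x | ∀ i j, F.Adj i j → (x i, x j) ∈ R}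

omit [MeasurableSpace X] [BorelSpace X] [SecondCountableTopology X]
  [TopologicalSpace.PseudoMetrizableSpace X] in
theorem isClosed_relHomSet (hR : IsClosed R) {p : ℕ} (F : SimpleGraph (Fin p)) :
    IsClosed (relHomSet R F) := by
  have : relHomSet R F = ⋂ (i) (j) (_ : F.Adj i j), (fun x : Fin p → X => (x i, x j)) ⁻¹' R := by
    ext x
    simp [relHomSet]
  rw [this]
  exact isClosed_iInter fun i => isClosed_iInter fun j => isClosed_iInter fun _ =>
    hR.preimage (by fun_prop)

omit [TopologicalSpace X] [BorelSpace X] [SecondCountableTopology X]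
  [TopologicalSpace.PseudoMetrizableSpace X] in
theorem measurableSet_relHomSet (hR : MeasurableSet R) {p : ℕ} (F : SimpleGraph (Fin p)) :
    MeasurableSet (relHomSet R F) := by
  have : relHomSet R F = ⋂ (i) (j) (_ : F.Adj i j), (fun x : Fin p → X => (x i, x j)) ⁻¹' R := by
    ext x
    simp [relHomSet]
  rw [this]
  exact MeasurableSet.iInter fun i => MeasurableSet.iInter fun j => MeasurableSet.iInter fun _ =>
    hR.preimage (by fun_prop)

-- When all edges map into `S`, failing to be a homomorphism into `R` means that one of finitely
-- many edges falls in the closed set `S ∩ Rᶜ`.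
omit [MeasurableSpace X] [BorelSpace X] [SecondCountableTopology X]
  [TopologicalSpace.PseudoMetrizableSpace X] in
theorem isClosed_relHomSet_diff {S : Set (X × X)} (h1 : IsClosed (S ∩ R)) (h0 : IsClosed (S ∩ Rᶜ))
    {p : ℕ} (F : SimpleGraph (Fin p)) : IsClosed (relHomSet S F ∩ (relHomSet R F)ᶜ) := by
  have hS : IsClosed S := by
    rw [← Set.inter_union_compl S R]
    exact h1.union h0
  have : relHomSet S F ∩ (relHomSet R F)ᶜ =
      relHomSet S F ∩ ⋃ (i) (j) (_ : F.Adj i j), (fun x : Fin p → X => (x i, x j)) ⁻¹' (S ∩ Rᶜ) := by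
    ext x
    simp only [relHomSet, Set.mem_inter_iff, Set.mem_ofPred_eq, Set.mem_compl_iff, not_forall,
      Set.mem_iUnion, Set.mem_preimage, exists_prop]
    refine and_congr_right fun hx => ⟨?_, ?_⟩
    · rintro ⟨i, j, hij, h⟩
      exact ⟨i, j, hij, hx i j hij, h⟩
    · rintro ⟨i, j, hij, -, h⟩
      exact ⟨i, j, hij, h⟩
  rw [this]
  exact (isClosed_relHomSet hS F).inter (isClosed_iUnion_of_finite fun i =>
    isClosed_iUnion_of_finite fun j => isClosed_iUnion_of_finite fun _ =>
      h0.preimage (by fun_prop))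

omit [L.NeBot] in
/-- If the relation `R` is clopen relative to closed sets of almost full measure, then the
homomorphism densities in `R` are continuous along the weakly convergent sequence. -/
theorem tendsto_measureReal_relHomSet (h : Tendsto μs L (𝓝 μ)) (hR : MeasurableSet R)
    (hS : ∀ ε > 0, ∃ S : Set (X × X), IsClosed (S ∩ R) ∧ IsClosed (S ∩ Rᶜ) ∧
      ∀ᶠ i in L, ((μs i : Measure X).prod (μs i : Measure X)).real Sᶜ ≤ ε)
    {p : ℕ} (F : SimpleGraph (Fin p)) :
    Tendsto (fun i => (Measure.pi fun _ : Fin p => (μs i : Measure X)).real (relHomSet R F)) L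
      (𝓝 ((Measure.pi fun _ : Fin p => (μ : Measure X)).real (relHomSet R F))) := by
  have hpi : Tendsto (fun i => ProbabilityMeasure.pi fun _ : Fin p => μs i) L
      (𝓝 (ProbabilityMeasure.pi fun _ : Fin p => μ)) :=
    (ProbabilityMeasure.continuous_pi.tendsto _).comp (tendsto_pi_nhds.2 fun _ => h)
  rw [Metric.tendsto_nhds]
  intro ε hε
  -- Chosen so that `p ^ 2 * η`, lost on pairs outside `S`, and `η`, lost in the weak limit, add up
  -- to `ε / 2`.
  set η := ε / (2 * ((p : ℝ) ^ 2 + 1)) with hη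
  have hη0 : 0 < η := by positivity
  obtain ⟨S, h1, h0, hSμ⟩ := hS η hη0
  have hSc : IsClosed S := by
    rw [← Set.inter_union_compl S R]
    exact h1.union h0
  have hm := measurableSet_relHomSet hR F
  have hinter : relHomSet S F ∩ relHomSet R F = relHomSet (S ∩ R) F := by
    ext x
    exact ⟨fun hx i j hij => ⟨hx.1 i j hij, hx.2 i j hij⟩,
      fun hx => ⟨fun i j hij => (hx i j hij).1, fun i j hij => (hx i j hij).2⟩⟩
  have c1 : IsClosed (relHomSet S F ∩ relHomSet R F) := hinter ▸ isClosed_relHomSet h1 F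
  have c0 := isClosed_relHomSet_diff h1 h0 F
  filter_upwards [hSμ, ProbabilityMeasure.eventually_measureReal_closed_le hpi c1 hη0,
    ProbabilityMeasure.eventually_measureReal_closed_le hpi c0 hη0] with i hi hi1 hi0
  rw [ProbabilityMeasure.toMeasure_pi, ProbabilityMeasure.toMeasure_pi] at hi1 hi0
  set P := Measure.pi fun _ : Fin p => (μs i : Measure X)
  set Q := Measure.pi fun _ : Fin p => (μ : Measure X)
  have hbad : P.real (relHomSet S F)ᶜ ≤ (p : ℝ) ^ 2 * η := by
    have hle := measureReal_exists_pair_le (ι := Fin p) (μs i : Measure X) hSc.measurableSet.compl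
    rw [Fintype.card_fin] at hle
    refine (measureReal_mono ?_).trans (hle.trans (mul_le_mul_of_nonneg_left hi (by positivity)))
    intro x hx
    simp only [relHomSet, Set.mem_compl_iff, Set.mem_ofPred_eq, not_forall] at hx
    obtain ⟨i, j, hij, hx⟩ := hx
    exact ⟨i, j, hij.ne, hx⟩
  have hsplit : ∀ B : Set (Fin p → X), P.real B ≤ P.real (relHomSet S F ∩ B) + (p : ℝ) ^ 2 * η := by
    intro B
    refine (measureReal_mono (s₂ := (relHomSet S F ∩ B) ∪ (relHomSet S F)ᶜ) ?_).trans
      ((measureReal_union_le _ _).trans (by gcongr))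
    intro x hx
    by_cases hxS : x ∈ relHomSet S F
    · exact Or.inl ⟨hxS, hx⟩
    · exact Or.inr hxS
  -- Closed sets give only upper bounds in the limit; the bound for the complement supplies the
  -- lower one.
  have b1 := hsplit (relHomSet R F)
  have b0 := hsplit (relHomSet R F)ᶜ
  have q1 : Q.real (relHomSet S F ∩ relHomSet R F) ≤ Q.real (relHomSet R F) :=
    measureReal_mono Set.inter_subset_right
  have q0 : Q.real (relHomSet S F ∩ (relHomSet R F)ᶜ) ≤ Q.real (relHomSet R F)ᶜ :=
    measureReal_mono Set.inter_subset_right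
  rw [probReal_compl_eq_one_sub hm] at b0 q0
  have hη2 : (p : ℝ) ^ 2 * η + η = ε / 2 := by
    rw [hη]
    field_simp
  rw [Real.dist_eq, abs_lt]
  constructor <;> linarith

/-- The point `(x, x)` lies in the open set `Sᶜ`, whose limit measure is at most `ε` by the
portmanteau theorem; its mass is the square of that of `x`. -/
theorem measure_singleton_eq_zero_of_tendsto (h : Tendsto μs L (𝓝 μ))
    (hS : ∀ ε > 0, ∃ S : Set (X × X), IsClosed S ∧ (∀ x, (x, x) ∉ S) ∧
      ∀ᶠ i in L, ((μs i : Measure X).prod (μs i : Measure X)).real Sᶜ ≤ ε) (x : X) :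
    (μ : Measure X) {x} = 0 := by
  have hprod : Tendsto (fun i => (μs i).prod (μs i)) L (𝓝 (μ.prod μ)) :=
    (ProbabilityMeasure.continuous_prod.tendsto (μ, μ)).comp (h.prodMk_nhds h)
  have hsq : (μ : Measure X).real {x} ^ 2 ≤ 0 := by
    refine le_of_forall_pos_le_add fun ε hε => ?_
    obtain ⟨S, hSc, hSd, hSμ⟩ := hS ε hε
    have := ProbabilityMeasure.measureReal_open_le_of_tendsto hprod hSc.isOpen_compl hSμ
    rw [zero_add, sq, ← measureReal_prod_prod, Set.singleton_prod_singleton]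
    refine le_trans (measureReal_mono ?_) this
    rintro _ rfl
    exact hSd x
  have h0 : (μ : Measure X).real {x} = 0 := by
    have := sq_nonneg ((μ : Measure X).real {x})
    exact pow_eq_zero_iff two_ne_zero |>.1 (le_antisymm hsq this)
  exact (measureReal_eq_zero_iff).1 h0

end RelationLimit

/-- The complement of the support is null, so densities may be computed on the whole of `A.T`. -/
theorem ColoredBorelTreeSemilattice.interp_homDensity {m : ℕ}
    (A : ColoredBorelTreeSemilattice.{u} (Palette m)) (μ : Measure A.T) [IsProbabilityMeasure μ]
    {p : ℕ} (F : SimpleGraph (Fin p)) :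
    (A.interp μ).homDensity F = (Measure.pi fun _ : Fin p => μ).real
      (relHomSet {e : A.T × A.T | A.InterpAdj e.1 e.2} F) := by
  have hs : MeasurableSet μ.support := Measure.isClosed_support.measurableSet
  have hmap : (μ.comap ((↑) : μ.support → A.T)).map ((↑) : μ.support → A.T) = μ := by
    rw [(MeasurableEmbedding.subtype_coe hs).map_comap, Subtype.range_coe_subtype]
    exact Measure.restrict_eq_self_of_ae_mem (mem_ae_iff.2 Measure.measure_compl_support)
  have := A.isProbabilityMeasure_comap_support μ
  have hpi := Measure.pi_map_pi (μ := fun _ : Fin p => μ.comap ((↑) : μ.support → A.T))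
    (f := fun _ => ((↑) : μ.support → A.T)) fun _ => measurable_subtype_coe.aemeasurable
  rw [hmap] at hpi
  rw [← hpi, map_measureReal_apply (by fun_prop)
    (measurableSet_relHomSet A.measurableSet_interpAdj F)]
  rfl

/-! ### Positions determined by keys -/

theorem measureReal_prod_le_of_fiber {X Y : Type*} [MeasurableSpace X] [MeasurableSpace Y]
    (μ : Measure X) (ν : Measure Y) [IsProbabilityMeasure μ] [IsProbabilityMeasure ν]
    {S : Set (X × Y)} (hS : MeasurableSet S) {b : ℝ} (hb : 0 ≤ b)
    (h : ∀ y, μ.real {x | (x, y) ∈ S} ≤ b) : (μ.prod ν).real S ≤ b := by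
  refine ENNReal.toReal_le_of_le_ofReal hb ?_
  rw [Measure.prod_apply_symm hS]
  refine (lintegral_mono fun y =>
    (ENNReal.le_ofReal_iff_toReal_le (measure_ne_top _ _) hb).2 (h y)).trans ?_
  simp

section Position

variable {Ω κ : Type*} [Finite Ω] [LinearOrder κ] (key : Ω → κ)

/-- The number of elements with smaller keys. -/
noncomputable def keyRank (x : Ω) : ℕ := {z | key z < key x}.ncard

variable {key}

theorem keyRank_lt_of_lt {x y : Ω} (h : key x < key y) : keyRank key x < keyRank key y :=
  Set.ncard_lt_ncard ⟨fun _ hz => lt_trans hz h, fun h' => (lt_irrefl (key x)) (h' h)⟩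
    (Set.toFinite _)

omit [Finite Ω] in
theorem keyRank_eq_of_eq {x y : Ω} (h : key x = key y) : keyRank key x = keyRank key y := by
  rw [keyRank, keyRank, h]

theorem keyRank_lt_card (x : Ω) : keyRank key x < Nat.card Ω := by
  rw [keyRank, ← Set.ncard_univ]
  exact Set.ncard_lt_ncard ⟨Set.subset_univ _, fun h => lt_irrefl (key x) (h (Set.mem_univ x))⟩
    (Set.toFinite _)

/-- For `x` of minimal key in the set, all its members have keys in `[key x, key y)`, and exactly
`keyRank key y - keyRank key x < D` elements do. -/
theorem ncard_keyRank_near_le (y : Ω) {D : ℝ} (hD : 0 ≤ D) :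
    ({x | key x < key y ∧ (keyRank key y : ℝ) < keyRank key x + D}.ncard : ℝ) ≤ D := by
  set S := {x | key x < key y ∧ (keyRank key y : ℝ) < keyRank key x + D} with hS
  rcases S.eq_empty_or_nonempty with h | h
  · rw [h]
    simpa using hD
  · obtain ⟨x, hx, hmin⟩ := (Set.toFinite S).exists_minimalFor key S h
    have hsub : S ⊆ {z | key z < key y} \ {z | key z < key x} := by
      intro z hz
      refine ⟨hz.1, fun h' => ?_⟩
      exact (hmin hz (le_of_lt h')).not_gt h'
    have h1 := Set.ncard_le_ncard hsub (Set.toFinite _)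
    have h2 : {z | key z < key x} ⊆ {z | key z < key y} := fun z hz => lt_trans hz hx.1
    have h3 := Set.ncard_sdiff_add_ncard_of_subset h2 (Set.toFinite _)
    have h4 : ((S.ncard : ℝ) + keyRank key x) ≤ keyRank key y := by
      have : S.ncard + keyRank key x ≤ keyRank key y := by
        rw [keyRank, keyRank, ← h3]
        exact Nat.add_le_add_right h1 _
      exact_mod_cast this
    linarith [hx.2]

variable (key)

/-- The position of an element in the upper half of the unit interval determined by the rank of its
key. -/
noncomputable def keyPos (x : Ω) : unitInterval :=
  -- Staying above `1 / 2` keeps positions away from the position `0` of the least letter, a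
  -- condition that is closed and survives limits.
  ⟨(1 + (keyRank key x : ℝ) / Nat.card Ω) / 2, by
    have h0 : (0 : ℝ) ≤ (keyRank key x : ℝ) / Nat.card Ω := by positivity
    have h1 : (keyRank key x : ℝ) / Nat.card Ω ≤ 1 :=
      div_le_one_of_le₀ (by exact_mod_cast (keyRank_lt_card x).le) (by positivity)
    constructor <;> linarith⟩

variable {key}

theorem half_le_keyPos (x : Ω) : (1 / 2 : ℝ) ≤ keyPos key x := by
  have h0 : (0 : ℝ) ≤ (keyRank key x : ℝ) / Nat.card Ω := by positivity
  change (1 / 2 : ℝ) ≤ (1 + (keyRank key x : ℝ) / Nat.card Ω) / 2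
  linarith

theorem keyPos_eq_of_eq {x y : Ω} (h : key x = key y) : keyPos key x = keyPos key y :=
  Subtype.ext (by simp only [keyPos, keyRank_eq_of_eq h])

theorem keyPos_lt_of_lt {x y : Ω} (h : key x < key y) : keyPos key x < keyPos key y := by
  have hN : (0 : ℝ) < Nat.card Ω := by
    exact_mod_cast (Nat.zero_le _).trans_lt (keyRank_lt_card (key := key) x)
  have h1 : (keyRank key x : ℝ) < keyRank key y := by exact_mod_cast keyRank_lt_of_lt h
  have h2 := div_lt_div_of_pos_right h1 hN
  change (1 + (keyRank key x : ℝ) / Nat.card Ω) / 2 < (1 + (keyRank key y : ℝ) / Nat.card Ω) / 2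
  linarith

variable [MeasurableSpace Ω] [MeasurableSingletonClass Ω]

/-- Ranks are squeezed into half an interval, so positions within `δ` mean ranks within `2 * δ *
|Ω|`; count these for each fixed second coordinate. -/
theorem measureReal_keyPos_near_le [Nonempty Ω] {δ : ℝ} (hδ : 0 ≤ δ) :
    ((uniformMeasure Ω).prod (uniformMeasure Ω)).real
      {e | key e.1 < key e.2 ∧ (keyPos key e.2 : ℝ) < keyPos key e.1 + δ} ≤ 2 * δ := by
  refine measureReal_prod_le_of_fiber _ _ (Set.toFinite _).measurableSet (by positivity)
    fun y => ?_
  have hN : (0 : ℝ) < Nat.card Ω := by exact_mod_cast Nat.card_pos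
  rw [uniformMeasure_real, Nat.card_coe_set_eq, div_le_iff₀ hN]
  refine le_trans ?_ (ncard_keyRank_near_le (key := key) y (by positivity))
  refine Nat.cast_le.2 (Set.ncard_le_ncard ?_ (Set.toFinite _))
  rintro x ⟨h1, h2⟩
  refine ⟨h1, ?_⟩
  change (1 + (keyRank key y : ℝ) / Nat.card Ω) / 2 <
    (1 + (keyRank key x : ℝ) / Nat.card Ω) / 2 + δ at h2
  have h3 : (keyRank key y : ℝ) / Nat.card Ω < (keyRank key x : ℝ) / Nat.card Ω + 2 * δ := by
    linarith
  rwa [div_lt_iff₀ hN, add_mul, div_mul_cancel₀ _ hN.ne'] at h3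

end Position

/-! ### Separated pairs of codes -/

section Separated

variable {m K : ℕ} (enc : SymFun m ≃ Fin (K + 1))

/-- The pairs of leaves whose codes first differ at place `j`, the position of the first being
smaller by at least `δ`. -/
def sepAt (K m : ℕ) (δ : ℝ) (j : ℕ) : Set (CodeSpace K m × CodeSpace K m) :=
  {e | e.1.2 ≠ 0 ∧ e.2.2 ≠ 0 ∧ (1 / 2 : ℝ) ≤ (e.1.1 j).1 ∧ (∀ l < j, e.1.1 l = e.2.1 l) ∧
    ((e.1.1 j).1 : ℝ) + δ ≤ (e.2.1 j).1}

/-- The pairs of leaves whose codes first differ at a place before `k`, with positions differing by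
at least `δ`. -/
def sepSet (K m : ℕ) (δ : ℝ) (k : ℕ) : Set (CodeSpace K m × CodeSpace K m) :=
  ⋃ j ∈ Set.Iio k, (sepAt K m δ j ∪ Prod.swap ⁻¹' sepAt K m δ j)

/-- The adjacency relation of the interpretation of the tree-semilattice of codes. -/
def codeAdj : Set (CodeSpace K m × CodeSpace K m) :=
  {e | (codeTree (m := m) (K := K) enc).InterpAdj e.1 e.2}

theorem measurableSet_codeAdj : MeasurableSet (codeAdj enc) :=
  (codeTree (m := m) (K := K) enc).measurableSet_interpAdj

theorem isClosed_sepAt (δ : ℝ) (j : ℕ) : IsClosed (sepAt K m δ j) := by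
  have h1 : IsClosed {e : CodeSpace K m × CodeSpace K m | e.1.2 ≠ 0} :=
    (isClosed_discrete ({0}ᶜ : Set (Fin (m + 1)))).preimage (by fun_prop)
  have h2 : IsClosed {e : CodeSpace K m × CodeSpace K m | e.2.2 ≠ 0} :=
    (isClosed_discrete ({0}ᶜ : Set (Fin (m + 1)))).preimage (by fun_prop)
  have h3 : IsClosed {e : CodeSpace K m × CodeSpace K m | (1 / 2 : ℝ) ≤ (e.1.1 j).1} :=
    isClosed_le (by fun_prop) (by fun_prop)
  have h4 : IsClosed {e : CodeSpace K m × CodeSpace K m | ∀ l < j, e.1.1 l = e.2.1 l} := by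
    simp only [Set.ofPred_forall]
    exact isClosed_iInter fun l => isClosed_iInter fun _ =>
      isClosed_eq (by fun_prop) (by fun_prop)
  have h5 : IsClosed {e : CodeSpace K m × CodeSpace K m |
      ((e.1.1 j).1 : ℝ) + δ ≤ (e.2.1 j).1} :=
    isClosed_le (by fun_prop) (by fun_prop)
  exact h1.inter (h2.inter (h3.inter (h4.inter h5)))

variable {enc}

theorem codeAdj_iff_of_mem_sepAt {δ : ℝ} (hδ : 0 < δ) {j : ℕ}
    {e : CodeSpace K m × CodeSpace K m} (he : e ∈ sepAt K m δ j) :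
    e ∈ codeAdj enc ↔ ∃ a b : Fin m, e.1.2 = a.succ ∧ e.2.2 = b.succ ∧
      (enc.symm (e.1.1 j).2).1 a b = true := by
  obtain ⟨h1, h2, h3, h4, h5⟩ := he
  obtain ⟨a, ha⟩ := Fin.exists_succ_eq.2 h1
  obtain ⟨b, hb⟩ := Fin.exists_succ_eq.2 h2
  have hlt : (e.1.1 j).1 < (e.2.1 j).1 := by
    have : ((e.1.1 j).1 : ℝ) < (e.2.1 j).1 := by linarith
    exact this
  have h0 : (e.1.1 j).1 ≠ 0 := by
    intro h
    rw [h] at h3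
    norm_num at h3
  have := codeTree_interpAdj_iff enc.injective ha.symm hb.symm h4 hlt h0
    (f := enc.symm (e.1.1 j).2) (enc.apply_symm_apply _).symm
  refine Iff.trans this ⟨fun h => ⟨a, b, ha.symm, hb.symm, h⟩, ?_⟩
  rintro ⟨a', b', ha', hb', h⟩
  cases Fin.succ_injective _ (ha.trans ha')
  cases Fin.succ_injective _ (hb.trans hb')
  exact h

/-- On `sepAt` adjacency depends only on the two labels and the color of the smaller letter, that
is, on a continuous map to a finite discrete space. -/
theorem isClosed_sepAt_inter {δ : ℝ} (hδ : 0 < δ) (j : ℕ) :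
    IsClosed (sepAt K m δ j ∩ codeAdj enc) ∧ IsClosed (sepAt K m δ j ∩ (codeAdj enc)ᶜ) := by
  let D : Set (Fin (m + 1) × Fin (m + 1) × Fin (K + 1)) :=
    {d | ∃ a b : Fin m, d.1 = a.succ ∧ d.2.1 = b.succ ∧ (enc.symm d.2.2).1 a b = true}
  let g : CodeSpace K m × CodeSpace K m → Fin (m + 1) × Fin (m + 1) × Fin (K + 1) :=
    fun e => (e.1.2, e.2.2, (e.1.1 j).2)
  have hg : Continuous g := by fun_prop
  have h1 : sepAt K m δ j ∩ codeAdj enc = sepAt K m δ j ∩ g ⁻¹' D :=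
    Set.ext fun e => and_congr_right fun he => codeAdj_iff_of_mem_sepAt hδ he
  have h0 : sepAt K m δ j ∩ (codeAdj enc)ᶜ = sepAt K m δ j ∩ g ⁻¹' Dᶜ :=
    Set.ext fun e => and_congr_right fun he => not_congr (codeAdj_iff_of_mem_sepAt hδ he)
  rw [h1, h0]
  exact ⟨(isClosed_sepAt δ j).inter ((isClosed_discrete D).preimage hg),
    (isClosed_sepAt δ j).inter ((isClosed_discrete Dᶜ).preimage hg)⟩

theorem codeAdj_swap {e : CodeSpace K m × CodeSpace K m} :
    e.swap ∈ codeAdj enc ↔ e ∈ codeAdj enc :=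
  ⟨fun h => ColoredBorelTreeSemilattice.InterpAdj.symm h,
    fun h => ColoredBorelTreeSemilattice.InterpAdj.symm h⟩

theorem isClosed_sepSet_inter {δ : ℝ} (hδ : 0 < δ) (k : ℕ) :
    IsClosed (sepSet K m δ k ∩ codeAdj enc) ∧ IsClosed (sepSet K m δ k ∩ (codeAdj enc)ᶜ) := by
  have hsw : Prod.swap ⁻¹' codeAdj enc = codeAdj enc := Set.ext fun e => codeAdj_swap
  constructor
  · rw [sepSet, Set.iUnion₂_inter]
    refine (Set.finite_Iio k).isClosed_biUnion fun j _ => ?_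
    rw [Set.union_inter_distrib_right]
    refine (isClosed_sepAt_inter hδ j).1.union ?_
    rw [← hsw, ← Set.preimage_inter]
    exact (isClosed_sepAt_inter hδ j).1.preimage continuous_swap
  · rw [sepSet, Set.iUnion₂_inter]
    refine (Set.finite_Iio k).isClosed_biUnion fun j _ => ?_
    rw [Set.union_inter_distrib_right]
    refine (isClosed_sepAt_inter hδ j).2.union ?_
    rw [← hsw, ← Set.preimage_compl, ← Set.preimage_inter]
    exact (isClosed_sepAt_inter hδ j).2.preimage continuous_swap

theorem isClosed_sepSet (δ : ℝ) (k : ℕ) : IsClosed (sepSet K m δ k) :=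
  (Set.finite_Iio k).isClosed_biUnion fun j _ =>
    (isClosed_sepAt δ j).union ((isClosed_sepAt δ j).preimage continuous_swap)

theorem diag_notMem_sepSet {δ : ℝ} (hδ : 0 < δ) (k : ℕ) (x : CodeSpace K m) :
    (x, x) ∉ sepSet K m δ k := by
  intro h
  simp only [sepSet, Set.mem_iUnion] at h
  obtain ⟨j, -, h | h⟩ := h
  · have := h.2.2.2.2
    simp only at this
    linarith
  · have := h.2.2.2.2
    simp only [Prod.swap_prod_mk] at this
    linarith

end Separated

/-! ### Codes of finite sets with keys -/

section Code

variable {m K : ℕ} {enc : SymFun m ≃ Fin (K + 1)} {Ω κ : Type*} [Finite Ω] [LinearOrder κ]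
  {key : ℕ → Ω → κ} {c : ℕ → Ω → SymFun m} {label : Ω → Fin m}

/-- The leaf of the tree-semilattice of codes given by keys, colors and a label. -/
noncomputable def keyCode (enc : SymFun m ≃ Fin (K + 1)) (key : ℕ → Ω → κ) (c : ℕ → Ω → SymFun m)
    (label : Ω → Fin m) (x : Ω) : CodeSpace K m :=
  (fun j => (keyPos (key j) x, enc (c j x)), (label x).succ)

theorem keyCode_letter_eq (hc : ∀ j x y, key j x = key j y → c j x = c j y) {j : ℕ} {x y : Ω}
    (h : key j x = key j y) :
    (keyCode enc key c label x).1 j = (keyCode enc key c label y).1 j :=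
  Prod.ext (keyPos_eq_of_eq h) (congrArg enc (hc j x y h))

theorem keyCode_mem_sepAt (hc : ∀ j x y, key j x = key j y → c j x = c j y) {δ : ℝ} {j : ℕ}
    {x y : Ω} (heq : ∀ i < j, key i x = key i y)
    (h : (keyPos (key j) x : ℝ) + δ ≤ keyPos (key j) y) :
    (keyCode enc key c label x, keyCode enc key c label y) ∈ sepAt K m δ j :=
  ⟨Fin.succ_ne_zero _, Fin.succ_ne_zero _, half_le_keyPos x,
    fun l hl => keyCode_letter_eq hc (heq l hl), h⟩

theorem keyCode_adj_iff (hc : ∀ j x y, key j x = key j y → c j x = c j y) {j : ℕ} {x y : Ω}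
    (heq : ∀ i < j, key i x = key i y) (hlt : key j x < key j y) :
    (keyCode enc key c label x, keyCode enc key c label y) ∈ codeAdj enc ↔
      (c j x).1 (label x) (label y) = true := by
  refine codeTree_interpAdj_iff enc.injective rfl rfl
    (fun l hl => keyCode_letter_eq hc (heq l hl)) (keyPos_lt_of_lt hlt) ?_ rfl
  intro h
  have h1 := half_le_keyPos (key := key j) x
  have h2 : ((keyPos (key j) x : unitInterval) : ℝ) = 0 := congrArg Subtype.val h
  rw [h2] at h1
  norm_num at h1

variable [MeasurableSpace Ω] [MeasurableSingletonClass Ω] [Nonempty Ω]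

/-- A pair that is not separated either agrees in its `k`-th keys, with the probability of one
class, or first differs at some `j ≤ k` with positions closer than `δ`, with probability at most `2
* δ` for each order of the two points. -/
theorem measureReal_not_sepSet_le (hc : ∀ j x y, key j x = key j y → c j x = c j y) {δ : ℝ}
    (hδ : 0 ≤ δ) (k : ℕ)
    (hcard : ∀ j y, {x | key j x = key j y}.ncard * 2 ^ j ≤ Nat.card Ω ∨
        {x | key j x = key j y}.ncard ≤ 1) :
    ((uniformMeasure Ω).prod (uniformMeasure Ω)).real {e : Ω × Ω |
      (keyCode enc key c label e.1, keyCode enc key c label e.2) ∉ sepSet K m δ (k + 1)} ≤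
      (k + 1) * (4 * δ) + ((1 / 2) ^ k + 1 / Nat.card Ω) := by
  set U := (uniformMeasure Ω).prod (uniformMeasure Ω)
  let N : ℕ → Set (Ω × Ω) := fun j =>
    {e | key j e.1 < key j e.2 ∧ (keyPos (key j) e.2 : ℝ) < keyPos (key j) e.1 + δ}
  have hNm : ∀ j, U.real (N j) ≤ 2 * δ := fun j => measureReal_keyPos_near_le hδ
  have hNs : ∀ j, U.real (Prod.swap ⁻¹' N j) ≤ 2 * δ := fun j => by
    refine le_trans (le_of_eq ?_) (hNm j)
    exact Measure.measurePreserving_swap.measureReal_preimage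
      (Set.toFinite _).measurableSet.nullMeasurableSet
  have hE : U.real {e | key k e.1 = key k e.2} ≤ (1 / 2) ^ k + 1 / Nat.card Ω := by
    refine measureReal_prod_le_of_fiber _ _ (Set.toFinite _).measurableSet (by positivity)
      fun y => ?_
    have hN : (0 : ℝ) < Nat.card Ω := by exact_mod_cast Nat.card_pos
    change (uniformMeasure Ω).real {x | key k x = key k y} ≤ _
    rw [uniformMeasure_real, Nat.card_coe_set_eq]
    rcases hcard k y with h | h
    · refine le_add_of_le_of_nonneg ?_ (by positivity)
      rw [div_le_iff₀ hN, one_div, inv_pow, inv_mul_eq_div, le_div_iff₀ (by positivity)]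
      exact_mod_cast h
    · refine le_add_of_nonneg_of_le (by positivity) ?_
      gcongr
      exact_mod_cast h
  have hsub : {e : Ω × Ω |
      (keyCode enc key c label e.1, keyCode enc key c label e.2) ∉ sepSet K m δ (k + 1)} ⊆
      (⋃ j ∈ Finset.range (k + 1), (N j ∪ Prod.swap ⁻¹' N j)) ∪ {e | key k e.1 = key k e.2} := by
    rintro ⟨x, y⟩ hxy
    by_cases hk : key k x = key k y
    · exact Or.inr hk
    left
    classical
    have hex : ∃ j, key j x ≠ key j y := ⟨k, hk⟩
    set j := Nat.find hex with hj
    have hjk : j ≤ k := Nat.find_min' hex hk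
    have heq : ∀ i < j, key i x = key i y := fun i hi => not_not.1 (Nat.find_min hex hi)
    have hne : key j x ≠ key j y := Nat.find_spec hex
    refine Set.mem_biUnion (x := j) (by simpa using Nat.lt_succ_of_le hjk) ?_
    rcases lt_or_gt_of_ne hne with hlt | hlt
    · refine Or.inl ⟨hlt, not_le.1 fun h => hxy ?_⟩
      exact Set.mem_biUnion (x := j) (Nat.lt_succ_of_le hjk)
        (Or.inl (keyCode_mem_sepAt hc heq h))
    · refine Or.inr ⟨hlt, not_le.1 fun h => hxy ?_⟩
      exact Set.mem_biUnion (x := j) (Nat.lt_succ_of_le hjk)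
        (Or.inr (keyCode_mem_sepAt hc (fun i hi => (heq i hi).symm) h))
  refine (measureReal_mono hsub).trans ((measureReal_union_le _ _).trans (add_le_add ?_ hE))
  refine (measureReal_biUnion_finset_le _ _).trans ?_
  refine (Finset.sum_le_card_nsmul _ _ (4 * δ) fun j _ => ?_).trans ?_
  · refine (measureReal_union_le _ _).trans ?_
    linarith [hNm j, hNs j]
  · simp

end Code

/-! ### Limits of `m`-partite cographs -/

theorem exists_symFun_equiv_fin (m : ℕ) : ∃ K : ℕ, Nonempty (SymFun m ≃ Fin (K + 1)) := by
  have : Nonempty (SymFun m) := ⟨⟨fun _ _ => false, fun _ _ => rfl⟩⟩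
  obtain ⟨n, ⟨e⟩⟩ := Finite.exists_equiv_fin (SymFun m)
  cases n with
  | zero => exact (e (Classical.arbitrary _)).elim0
  | succ K => exact ⟨K, ⟨e⟩⟩

theorem IsMPartiteCograph.finite {m : ℕ} {V : Type u} {G : SimpleGraph V}
    (hG : IsMPartiteCograph m G) : Finite V := by
  obtain ⟨T, hT, leaf, -⟩ := hG
  exact Finite.of_equiv _ leaf.symm

theorem IsMPartiteCograph.nonempty {m : ℕ} {V : Type u} {G : SimpleGraph V}
    (hG : IsMPartiteCograph m G) : Nonempty V := by
  obtain ⟨T, hT, leaf, -⟩ := hG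
  obtain ⟨t, ht⟩ := Set.finite_univ.exists_maximal (⟨⊥, trivial⟩ : (Set.univ : Set T).Nonempty)
  exact ⟨leaf.symm ⟨t, fun s hs => ht.2 trivial hs⟩⟩

theorem uniformMeasure_map_fst {V W : Type*} [Finite V] [Finite W] [Nonempty W]
    [MeasurableSpace V] [MeasurableSpace W] [MeasurableSingletonClass V]
    [MeasurableSingletonClass W] [Nonempty V] :
    (uniformMeasure (V × W)).map Prod.fst = uniformMeasure V := by
  refine Measure.ext fun S hS => ?_
  rw [Measure.map_apply measurable_fst hS]
  have hW : (Nat.card W : ℝ) ≠ 0 := by exact_mod_cast Nat.card_pos.ne'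
  have h : (uniformMeasure (V × W)).real (Prod.fst ⁻¹' S) = (uniformMeasure V).real S := by
    rw [uniformMeasure_real, uniformMeasure_real, Nat.card_prod, ← Set.prod_univ,
      Nat.card_coe_set_eq, Nat.card_coe_set_eq, Set.ncard_prod, Set.ncard_univ, Nat.cast_mul,
      Nat.cast_mul, mul_div_mul_right _ _ hW]
  exact (measureReal_eq_measureReal_iff).1 h

/-- Blow-ups of `m`-partite cographs, coded by leaves of the universal tree-semilattice. -/
theorem IsMPartiteCograph.exists_code {m K : ℕ} (enc : SymFun m ≃ Fin (K + 1)) {V : Type u}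
    {G : SimpleGraph V} (hG : IsMPartiteCograph m G) (n : ℕ) :
    ∃ μ : ProbabilityMeasure (CodeSpace K m),
      (∀ (p : ℕ) (F : SimpleGraph (Fin p)), homDensity F G =
        (Measure.pi fun _ : Fin p => (μ : Measure (CodeSpace K m))).real
          (relHomSet (codeAdj enc) F)) ∧
      ∀ (δ : ℝ) (k : ℕ), 0 ≤ δ →
        ((μ : Measure (CodeSpace K m)).prod (μ : Measure (CodeSpace K m))).real
          (sepSet K m δ (k + 1))ᶜ ≤ (k + 1) * (4 * δ) + ((1 / 2) ^ k + 1 / (n + 1)) := by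
  have := hG.finite
  have := hG.nonempty
  obtain ⟨key, c, label, hc, hadj, hcard⟩ := hG.exists_keys (n + 1)
  let : MeasurableSpace V := ⊤
  have : MeasurableSingletonClass V := ⟨fun _ => trivial⟩
  let Ω := V × Fin (n + 1)
  let code : Ω → CodeSpace K m := keyCode enc key c fun x => label x.1
  have hcode : ∀ x y : Ω, (code x, code y) ∈ codeAdj enc ↔ G.Adj x.1 y.1 := by
    intro x y
    by_cases hxy : ∃ j, key j x ≠ key j y
    · classical
      set j := Nat.find hxy
      have heq : ∀ i < j, key i x = key i y := fun i hi => not_not.1 (Nat.find_min hxy hi)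
      rcases lt_or_gt_of_ne (show key j x ≠ key j y from Nat.find_spec hxy) with hlt | hlt
      · rw [hadj j x y heq hlt]
        exact keyCode_adj_iff hc heq hlt
      · have heq' : ∀ i < j, key i y = key i x := fun i hi => (heq i hi).symm
        rw [G.adj_comm, hadj j y x heq' hlt, ← codeAdj_swap,
          Prod.swap_prod_mk]
        exact keyCode_adj_iff hc heq' hlt
    · simp only [ne_eq, not_exists, not_not] at hxy
      have hxy' : x = y := by
        -- As `2 ^ |Ω| > |Ω|`, a class at this place has at most one element, so points with all
        -- keys equal coincide.
        have h1 : {z | key (Nat.card Ω) z = key (Nat.card Ω) y}.ncard ≤ 1 := by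
          rcases hcard (Nat.card Ω) y with h | h
          · by_contra hlt
            have := Nat.mul_le_mul_right (2 ^ Nat.card Ω) (not_le.1 hlt).le
            have h2 := Nat.lt_two_pow_self (n := Nat.card Ω)
            have h3 : Nat.card Ω = Nat.card (V × Fin (n + 1)) := rfl
            omega
          · exact h
        exact (Set.ncard_le_one (Set.toFinite _)).1 h1 _ (hxy _) _ rfl
      subst hxy'
      simp only [SimpleGraph.irrefl, iff_false]
      exact (codeTree enc).not_interpAdj_self _
  have hmeas : Measurable code := measurable_of_finite code
  let μ : ProbabilityMeasure (CodeSpace K m) :=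
    ⟨(uniformMeasure Ω).map code, Measure.isProbabilityMeasure_map hmeas.aemeasurable⟩
  have hμ : (μ : Measure (CodeSpace K m)) = (uniformMeasure Ω).map code := rfl
  refine ⟨μ, fun p F => ?_, fun δ k hδ => ?_⟩
  · have hpi := Measure.pi_map_pi (μ := fun _ : Fin p => uniformMeasure Ω)
      (f := fun _ => code) fun _ => hmeas.aemeasurable
    -- Projecting the blow-up to `V` preserves uniform measures, so blowing up leaves homomorphism
    -- densities unchanged.
    have hpi' := Measure.pi_map_pi (μ := fun _ : Fin p => uniformMeasure Ω)
      (f := fun _ => (Prod.fst : Ω → V)) fun _ => measurable_fst.aemeasurable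
    rw [uniformMeasure_map_fst] at hpi'
    have hfst : Measurable fun (x : Fin p → V × Fin (n + 1)) i => (x i).1 := by fun_prop
    rw [homDensity_eq_measureReal, hμ, ← hpi, ← hpi',
      map_measureReal_apply hfst (Set.toFinite _).measurableSet,
      map_measureReal_apply (by fun_prop) (measurableSet_relHomSet (measurableSet_codeAdj enc) F)]
    congr 1
    ext x
    exact forall₃_congr fun i j _ => (hcode (x i) (x j)).symm
  · have hprod := Measure.map_prod_map (uniformMeasure Ω) (uniformMeasure Ω) hmeas hmeas
    rw [hμ, hprod, map_measureReal_apply (by fun_prop)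
      (isClosed_sepSet δ (k + 1)).measurableSet.compl]
    refine (measureReal_not_sepSet_le hc hδ k hcard).trans ?_
    gcongr
    rw [Nat.card_prod, Nat.card_eq_fintype_card (α := Fin (n + 1)), Fintype.card_fin]
    have h1 : n + 1 ≤ Nat.card V * (n + 1) := Nat.le_mul_of_pos_left _ Nat.card_pos
    exact_mod_cast h1

theorem exists_limit_of_leftConvergent {m : ℕ} {V : ℕ → Type u} {G : ∀ n, SimpleGraph (V n)}
    (hG : ∀ n, IsMPartiteCograph m (G n)) (hconv : LeftConvergent G) :
    ∃ (A : ColoredBorelTreeSemilattice.{0} (Palette m)) (μ : Measure A.T)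
      (_ : IsProbabilityMeasure μ), (∀ x, μ {x} = 0) ∧ (A.interp μ).IsLeftLimit G := by
  obtain ⟨K, ⟨enc⟩⟩ := exists_symFun_equiv_fin m
  choose μs hhom hsep using fun n => (hG n).exists_code enc n
  -- Probability measures on the compact code space form a compact space, so a nonprincipal
  -- ultrafilter gives a weak limit without choosing a subsequence.
  let L : Ultrafilter ℕ := Filter.hyperfilter ℕ
  have hL : (L : Filter ℕ) ≤ atTop := Nat.cofinite_eq_atTop ▸ Filter.hyperfilter_le_cofinite
  obtain ⟨μ, -, hμ⟩ := isCompact_univ.ultrafilter_le_nhds (L.map μs) (by simp)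
  have hlim : Tendsto μs L (𝓝 μ) := hμ
  have hS : ∀ ε > 0, ∃ (δ : ℝ) (k : ℕ), 0 < δ ∧ ∀ᶠ n in (L : Filter ℕ),
      ((μs n : Measure (CodeSpace K m)).prod (μs n : Measure (CodeSpace K m))).real
        (sepSet K m δ (k + 1))ᶜ ≤ ε := by
    intro ε hε
    obtain ⟨k, hk⟩ := exists_pow_lt_of_lt_one (show (0 : ℝ) < ε / 4 by positivity) one_half_lt_one
    -- The near-collision term becomes `ε / 2`; the two terms for equal keys are below `ε / 4` each.
    refine ⟨ε / (8 * (k + 1)), k, by positivity, ?_⟩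
    have hev : ∀ᶠ n : ℕ in atTop, 1 / ((n : ℝ) + 1) < ε / 4 :=
      (tendsto_one_div_add_atTop_nhds_zero_nat (𝕜 := ℝ)).eventually
        (gt_mem_nhds (show (0 : ℝ) < ε / 4 by positivity))
    filter_upwards [hL hev] with n hn
    refine (hsep n _ k (by positivity)).trans ?_
    have h1 : ((k : ℝ) + 1) * (4 * (ε / (8 * (k + 1)))) = ε / 2 := by
      field_simp
      norm_num
    have hn' : 1 / ((n : ℝ) + 1) < ε / 4 := hn
    rw [h1]
    linarith
  have hatom : ∀ x, (μ : Measure (CodeSpace K m)) {x} = 0 := by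
    refine measure_singleton_eq_zero_of_tendsto hlim fun ε hε => ?_
    obtain ⟨δ, k, hδ, h⟩ := hS ε hε
    exact ⟨_, isClosed_sepSet δ (k + 1), diag_notMem_sepSet hδ (k + 1), h⟩
  let ν : Measure (codeTree (K := K) enc).T := (μ : Measure (CodeSpace K m))
  have hν : IsProbabilityMeasure ν := μ.2
  refine ⟨codeTree enc, ν, hν, hatom, ?_⟩
  · intro p F
    have hF := tendsto_measureReal_relHomSet hlim (measurableSet_codeAdj enc) (fun ε hε => by
      obtain ⟨δ, k, hδ, h⟩ := hS ε hε
      exact ⟨_, (isClosed_sepSet_inter hδ (k + 1)).1, (isClosed_sepSet_inter hδ (k + 1)).2, h⟩) F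
    simp only [← hhom] at hF
    -- Left convergence upgrades the limit along the ultrafilter to the limit of the whole sequence.
    obtain ⟨l, hl⟩ := hconv p F
    have heq := tendsto_nhds_unique hF (hl.mono_left hL)
    have hH := (codeTree (K := K) enc).interp_homDensity ν F
    rw [hH]
    refine Eq.subst (motive := fun r => Tendsto (fun n => homDensity F (G n)) atTop (𝓝 r))
      heq.symm hl

theorem theorem6p3 (m : ℕ) (hm : 1 ≤ m) :
    (∀ (V : ℕ → Type u) (G : ∀ n, SimpleGraph (V n)),
      (∀ n, IsMPartiteCograph m (G n)) → LeftConvergent G →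
      ∃ (A : ColoredBorelTreeSemilattice.{0} (Palette m)) (μ : Measure A.T)
        (_ : IsProbabilityMeasure μ),
        (∀ x, μ {x} = 0) ∧ (A.interp μ).IsLeftLimit G ∧
        (Tendsto (fun n => Nat.card (V n)) atTop atTop → (A.interp μ).IsQFLimit G)) ∧
    (∀ (A : ColoredBorelTreeSemilattice.{v} (Palette m)) (μ : Measure A.T)
      [IsProbabilityMeasure μ], (∀ x, μ {x} = 0) →
      ∃ (V : ℕ → Type) (G : ∀ n, SimpleGraph (V n)),
        (∀ n, IsMPartiteCograph m (G n)) ∧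
        Tendsto (fun n => Nat.card (V n)) atTop atTop ∧
        (A.interp μ).IsLeftLimit G ∧ (A.interp μ).IsQFLimit G) := by
  refine ⟨fun V G hG hconv => ?_, fun A μ _ h0 =>
    exists_seq_isMPartiteCograph hm A μ (A.interp_singleton μ h0)⟩
  obtain ⟨A, μ, hμ, h0, hlim⟩ := exists_limit_of_leftConvergent hG hconv
  exact ⟨A, μ, hμ, h0, hlim, hlim.isQFLimit (fun n => (hG n).finite) (fun n => (hG n).nonempty)
    (A.interp_singleton μ h0)⟩
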